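/- Let $K$ be a field with prime subfield $k$ (so $k=\mathbb Q$ or $k=\mathbb F_p$), let $\tilde k\subseteq K$ be a subfield, let $L$ be a field and $\tilde l\subseteq L$ a subfield that is algebraically closed in $L$. For elements $x_1,x_2$ of $K^\times/k^\times$ (respectively of $L^\times/\tilde l^\times$) write $x_1\sim x_2$ if lifts of them generate an extension of $\tilde k$ (respectively of $\tilde l$) of transcendence degree at most $1$. Put $A:=L^\times/\tilde l^\times$, regard $\mathbb P(K):=K^\times/k^\times$ as a projective space over $k$, and let $$\psi:\mathbb P(K)=K^\times/k^\times\to A$$ be a group homomorphism such that $x_1\sim x_2$ implies $\psi(x_1)\sim\psi(x_2)$. A map $f$ from a projective line $\mathfrak l$ over a field to a set is called a linear flag map if it is constant on $\mathfrak l\setminus\{\mathfrak q\}$ for some point $\mathfrak q\in\mathfrak l$. If $k=\mathbb Q$, a map $f$ on a line $\mathfrak l\simeq\mathbb P^1(\mathbb Q)$ is said to be induced from a map $\bar f$ on $\mathbb P^1(\mathbb Z/p)$, $p$ a prime, if $f=\bar f\circ\rho$, where $\rho:\mathfrak l\to\mathbb P^1(\mathbb Z/p)$ is the reduction map given by some $\mathbb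 Z_{(p)}$-lattice $\mathbb Z_{(p)}^2\simeq B\subset\mathbb Q^2$. A map on a line over $k$ is a flag map if it is a linear flag map or if $k=\mathbb Q$ and it is induced from a linear flag map on $\mathbb P^1(\mathbb Z/p)$ for some prime $p$. A line $\mathfrak l\subset\mathbb P(K)$ is of type $(\mathrm F)$ if the restriction $\psi_{\mathfrak l}$ is a nonconstant flag map and is not induced (with $k=\mathbb Q$) from a map $\mathbb P^1(\mathbb Z/p)\to A$ for any prime $p$. Let $\mathfrak u\subset\mathbb P(K)$ be the union of all lines through $1$ on which $\psi$ is injective, and put $\mathfrak U:=\{xy\mid x,y\in\mathfrak u\}$. Assume that there are $y_1,y_2\in\psi(\mathfrak u)$ with $y_1\not\sim y_2$, and that $\mathbb P(K)$ contains a line of type $(\mathrm F)$. Then there exists a valuation $\nu$ of $K$ (a homomorphism from $K^\times$ onto a totally ordered abelian group satisfying the nonarchimedean triangle inequality), with valuation ring $\mathfrak o_\nu$ and maximal ideal $\mathfrak m_\nu$, such that the image of $\mathfrak o_\nu^\times$ in $K^\times/k^\times$ is contained in $\mathfrak U$ and $\psi$ is trivial on the image of $1+\mathfrak m_\nu$.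 -/

import Mathlib

open scoped LinearAlgebra.Projectivization

universe u v w

noncomputable section

namespace AlgDepHom

/-- The nonzero elements of a subfield `F` of `K`, as a subgroup of `Kˣ`. -/
def unitsOf {K : Type u} [Field K] (F : Subfield K) : Subgroup Kˣ :=
  (Units.map (F.subtype : F →* K)).range

theorem mem_unitsOf {K : Type u} [Field K] {F : Subfield K} {x : Kˣ} :
    x ∈ unitsOf F ↔ (x : K) ∈ F := by
  constructor
  · rintro ⟨y, rfl⟩
    exact (y : F).2
  · intro hx
    have hne : (⟨(x : K), hx⟩ : F) ≠ 0 := fun h => x.ne_zero (congrArg Subtype.val h)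
    exact ⟨Units.mk0 _ hne, Units.ext rfl⟩

/-- The prime subfield `k` of `K`. -/
abbrev PrimeField (K : Type u) [Field K] : Subfield K := ⊥

/-- The group `ℙ(K) = Kˣ / kˣ`, where `k` is the prime subfield of `K`. -/
abbrev PK (K : Type u) [Field K] : Type u := Kˣ ⧸ unitsOf (PrimeField K)

/-- Algebraic dependence with respect to the subfield `F` of two classes modulo a subgroup `H`
of `Kˣ`: lifts `x, y` satisfy `tr.deg_F F(x, y) ≤ 1`. It is used for subgroups `H` of `Fˣ`, for
which it does not depend on the lifts. -/
def AlgDep {K : Type u} [Field K] (F : Subfield K) {H : Subgroup Kˣ} (a b : Kˣ ⧸ H) : Prop :=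
  ∃ x y : Kˣ, (x : Kˣ ⧸ H) = a ∧ (y : Kˣ ⧸ H) = b ∧
    Algebra.trdeg F (IntermediateField.adjoin F {(x : K), (y : K)}) ≤ 1

/-- The homomorphism `ψ` preserves algebraic dependence with respect to `kt` and `lt`. -/
def PreservesAlgDep {K : Type u} [Field K] {L : Type v} [Field L] (kt : Subfield K)
    (lt : Subfield L) (ψ : PK K →* Lˣ ⧸ unitsOf lt) : Prop :=
  ∀ x₁ x₂ : PK K, AlgDep kt x₁ x₂ → AlgDep lt (ψ x₁) (ψ x₂)

/-- A projective line in `ℙ(K)` is given by a two-dimensional `k`-subspace of `K`. -/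
def IsLine {K : Type u} [Field K] (V : Submodule (PrimeField K) K) : Prop :=
  Module.finrank (PrimeField K) V = 2

/-- The points of `ℙ(K)` on the projective subspace given by `V`. -/
def points {K : Type u} [Field K] (V : Submodule (PrimeField K) K) : Set (PK K) :=
  {P | ∃ x : Kˣ, (x : K) ∈ V ∧ (x : PK K) = P}

/-- The restriction of a map `f` on `ℙ(K)` to the projective subspace given by `V`. -/
def restrict {K : Type u} [Field K] {A : Type w} (f : PK K → A)
    (V : Submodule (PrimeField K) K) : ℙ (PrimeField K) V → A :=
  Projectivization.lift
    (fun v : {v : V // v ≠ 0} =>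
      f (Units.mk0 ((v : V) : K) (fun h => v.2 (Subtype.ext h)) : Kˣ))
    (by
      rintro ⟨a, ha⟩ ⟨b, hb⟩ t h
      simp only at h
      have hbK : (b : K) ≠ 0 := fun h' => hb (Subtype.ext h')
      have haK : (a : K) ≠ 0 := fun h' => ha (Subtype.ext h')
      refine congrArg f (QuotientGroup.eq.2 (mem_unitsOf.2 ?_))
      have hab : (a : K) = (t : K) * (b : K) := by rw [h]; rfl
      have ht : (t : K) ≠ 0 := fun h' => haK (by rw [hab, h', zero_mul])
      have : ((Units.mk0 (a : K) haK)⁻¹ * Units.mk0 (b : K) hbK : Kˣ) = ((t : K))⁻¹ := by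
        simp only [Units.val_mul, Units.val_inv_eq_inv_val, Units.val_mk0]
        rw [hab]
        field_simp
      rw [this]
      exact inv_mem t.2)

/-- For a projective line `ℙ F V` (`dim V = 2`): there is a flag `ℙ¹ ⊃ ℙ⁰ = {q}` such that `f` is
constant on `ℙ¹ ∖ ℙ⁰`. -/
def IsLinearFlagMap {F : Type u} [Field F] {V : Type v} [AddCommGroup V] [Module F V]
    {A : Type w} (f : ℙ F V → A) : Prop :=
  ∃ (q : ℙ F V) (a : A), ∀ x : ℙ F V, x ≠ q → f x = a

/-- For a projective line `ℙ F V` over `F = ℚ` and a basis `e` of `V`, spanning the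
`ℤ_(p)`-lattice `B = ℤ_(p) e₀ ⊕ ℤ_(p) e₁`: the map `f` equals `fbar ∘ ρ_B`, where
`ρ_B : ℙ¹(ℚ) → ℙ¹(ℤ/p)` is the reduction map of `B`. Every point of `ℙ F V` has a
representative `m e₀ + n e₁` in `B ∖ pB` with integers `m, n`, and `ρ_B` maps it to
`[m mod p : n mod p]`. -/
def IsInducedVia {F : Type u} [Field F] {V : Type v} [AddCommGroup V] [Module F V]
    {A : Type w} (f : ℙ F V → A) (p : ℕ) [Fact p.Prime] (e : Module.Basis (Fin 2) F V)
    (fbar : ℙ (ZMod p) (Fin 2 → ZMod p) → A) : Prop :=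
  ∀ (m n : ℤ) (hv : (m : F) • e 0 + (n : F) • e 1 ≠ 0)
    (hred : (![(m : ZMod p), (n : ZMod p)] : Fin 2 → ZMod p) ≠ 0),
    f (Projectivization.mk F _ hv) = fbar (Projectivization.mk (ZMod p) _ hred)

/-- A map on a projective line over a prime field `F` is induced from a map on `ℙ¹(ℤ/p)`, for some
prime `p`, via some lattice. This only makes sense for `F = ℚ`. -/
def IsInduced {F : Type u} [Field F] {V : Type v} [AddCommGroup V] [Module F V]
    {A : Type w} (f : ℙ F V → A) : Prop :=
  CharZero F ∧ ∃ (p : ℕ) (_ : Fact p.Prime) (e : Module.Basis (Fin 2) F V)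
    (fbar : ℙ (ZMod p) (Fin 2 → ZMod p) → A), IsInducedVia f p e fbar

/-- Flag maps on a projective line over a prime field `F`. -/
def IsFlagMap {F : Type u} [Field F] {V : Type v} [AddCommGroup V] [Module F V]
    {A : Type w} (f : ℙ F V → A) : Prop :=
  IsLinearFlagMap f ∨
    (CharZero F ∧ ∃ (p : ℕ) (_ : Fact p.Prime) (e : Module.Basis (Fin 2) F V)
      (fbar : ℙ (ZMod p) (Fin 2 → ZMod p) → A), IsLinearFlagMap fbar ∧ IsInducedVia f p e fbar)

/-- The line given by `V` is of type (F) with respect to `f`: the restriction of `f` to it is not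
induced from a map on `ℙ¹(ℤ/p)` and is a nonconstant flag map. -/
def IsTypeF {K : Type u} [Field K] {A : Type w} (f : PK K → A)
    (V : Submodule (PrimeField K) K) : Prop :=
  IsLine V ∧ ¬ IsInduced (restrict f V) ∧ (¬ ∃ a : A, ∀ x, restrict f V x = a) ∧
    IsFlagMap (restrict f V)

/-- The union `𝔲` of all lines through `1` on which `f` is injective. -/
def smallU {K : Type u} [Field K] {A : Type w} (f : PK K → A) : Set (PK K) :=
  {P | ∃ V : Submodule (PrimeField K) K, IsLine V ∧ (1 : PK K) ∈ points V ∧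
    Function.Injective (restrict f V) ∧ P ∈ points V}

/-- The set `𝔘` of products of two elements of `𝔲`. -/
def bigU {K : Type u} [Field K] {A : Type w} (f : PK K → A) : Set (PK K) :=
  {P | ∃ x ∈ smallU f, ∃ y ∈ smallU f, P = x * y}

end AlgDepHom

end

/-! Extend ψ by zero to a multiplicative map f on K. Since the base field is algebraically closed in
L, dependence divides the nontrivial values into classes, each of which together with 1 is a
torsion-free subgroup, and f sends x and x + c, with c in k, to dependent values. This and an
independent pair on injective lines are all that is used (`IsDependenceHom`). The basic device is to
write one sum in two ways, so that a quotient of values is forced into two different classes and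
hence equals 1.

If x and y lie on injective lines through 1 and have independent values, then x + y and xy lie on
such lines too (`lineInj_add`, `lineInj_mul`). Multiplying by a w independent of finitely many given
values reduces other products to this case. So the products of two such elements form a group P,
whose elements outside the kernel of f lie on injective lines (`prodInj_mul`, `lineInj_of_prodInj`).
Hence P is closed under sums of elements with distinct values (`prodInj_add`).

On a line through 1 that is not injective, f is constant off one point
(`map_add_const_of_not_lineInj`). So for x outside P and w in P with f w ≠ f x, the value f (w + x)
is f w or f x, and which one occurs does not depend on w (`map_add_eq_of_prodInj`). Therefore
exactly one of x, x⁻¹ is infinitesimal with respect to P. For infinitesimal x, 1 + x lies in P and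
in the kernel of f (`one_add_isSmall`). It follows that 0, P and the infinitesimals form a valuation
ring with unit group P (`valuationSubring`). -/

namespace AlgDepHom

/-! ### Abstract dependence relations and maps compatible with them -/

section Dependence

variable {K : Type u} [Field K] {G : Type v} [CommGroupWithZero G]

/-- The map `f` is injective on the projective line over `k` through `1` and `x`, whose points are
`1` and the `x + c` with `c ∈ k`. -/
def LineInj (k : Subfield K) (f : K →*₀ G) (x : K) : Prop :=
  (∀ c ∈ k, f (x + c) ≠ 1) ∧ ∀ c ∈ k, ∀ d ∈ k, f (x + c) = f (x + d) → c = d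

/-- The products of two elements on lines through `1` on which `f` is injective. -/
def ProdInj (k : Subfield K) (f : K →*₀ G) (x : K) : Prop :=
  ∃ u v, LineInj k f u ∧ LineInj k f v ∧ x = u * v

/-- A dependence relation on a group with zero: the nontrivial elements of the group are
partitioned into equivalence classes, each of which is a torsion-free subgroup without `1`. -/
structure IsDependence (D : G → G → Prop) : Prop where
  zero_left : ∀ b, D 0 b
  one_left : ∀ b, D 1 b
  refl : ∀ a, D a a
  symm : ∀ {a b}, D a b → D b a
  trans : ∀ {a b c}, b ≠ 0 → b ≠ 1 → D a b → D b c → D a c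
  mul_right : ∀ {a b c}, D a b → D a c → D a (b * c)
  inv_right : ∀ {a b}, D a b → D a b⁻¹
  pow_ne_one : ∀ {a : G} {n : ℕ}, a ≠ 0 → a ≠ 1 → n ≠ 0 → a ^ n ≠ 1

/-- A multiplicative map, trivial on the subfield `k`, that maps every line over `k` through `1`
to dependent elements, and for which there are independent elements on injective lines. -/
structure IsDependenceHom (k : Subfield K) (f : K →*₀ G) (D : G → G → Prop) : Prop
    extends IsDependence D where
  map_eq_one : ∀ c ∈ k, c ≠ 0 → f c = 1
  dep_add : ∀ x, ∀ c ∈ k, D (f x) (f (x + c))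
  exists_pair : ∃ a b, LineInj k f a ∧ LineInj k f b ∧ ¬ D (f a) (f b)

namespace IsDependence

variable {D : G → G → Prop} {a b c t : G}

theorem zero_right (h : IsDependence D) : D a 0 := h.symm (h.zero_left a)

theorem one_right (h : IsDependence D) : D a 1 := h.symm (h.one_left a)

theorem div_right (h : IsDependence D) (hb : D a b) (hc : D a c) : D a (b / c) := by
  rw [div_eq_mul_inv]
  exact h.mul_right hb (h.inv_right hc)

theorem ne_zero_left (h : IsDependence D) (hab : ¬ D a b) : a ≠ 0 :=
  fun ha => hab (ha ▸ h.zero_left b)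

theorem ne_one_left (h : IsDependence D) (hab : ¬ D a b) : a ≠ 1 :=
  fun ha => hab (ha ▸ h.one_left b)

theorem not_symm (h : IsDependence D) (hab : ¬ D a b) : ¬ D b a := fun hba => hab (h.symm hba)

theorem ne (h : IsDependence D) (hab : ¬ D a b) : a ≠ b := fun e => hab (e ▸ h.refl a)

theorem ne_zero_right (h : IsDependence D) (hab : ¬ D a b) : b ≠ 0 :=
  h.ne_zero_left (h.not_symm hab)

theorem ne_one_right (h : IsDependence D) (hab : ¬ D a b) : b ≠ 1 :=
  h.ne_one_left (h.not_symm hab)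

theorem of_div_right (h : IsDependence D) (hc₀ : c ≠ 0) (hc : D a c) (hbc : D a (b / c)) :
    D a b := by
  simpa [div_mul_cancel₀ b hc₀] using h.mul_right hbc hc

theorem of_div_left (h : IsDependence D) (hb₀ : b ≠ 0) (hb : D a b) (hbc : D a (b / c)) :
    D a c := by
  by_cases hc : c = 0
  · exact hc ▸ h.zero_right
  · have := h.div_right hb hbc
    rwa [div_div_cancel₀ hb₀] at this

/-- Replacing an element by a nontrivial dependent one preserves independence. -/
theorem not_dep_of_dep (h : IsDependence D) (hab : ¬ D a b) (hac : D a c) (hc₀ : c ≠ 0)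
    (hc : c ≠ 1) : ¬ D c b :=
  fun hcb => hab (h.trans hc₀ hc hac hcb)

/-- Two independent elements are both dependent only on `1`. -/
theorem eq_one_of_dep (h : IsDependence D) (hab : ¬ D a b) (ha : D a t) (hb : D b t)
    (ht : t ≠ 0) : t = 1 := by
  by_contra h1
  exact hab (h.trans ht h1 ha (h.symm hb))

theorem not_dep_inv_right (h : IsDependence D) (hab : ¬ D a b) : ¬ D a b⁻¹ :=
  fun hd => hab (by simpa using h.inv_right hd)

end IsDependence

/-! ### Injective lines through 1 -/

namespace LineInj

variable {k : Subfield K} {f : K →*₀ G} {x : K}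

theorem ne_one (hx : LineInj k f x) : f x ≠ 1 := by
  simpa using hx.1 0 k.zero_mem

theorem notMem (hx : LineInj k f x) : x ∉ k := by
  intro hk
  refine hx.1 (1 - x) (k.sub_mem k.one_mem hk) ?_
  simp

theorem ne_zero (hx : LineInj k f x) : x ≠ 0 := fun h0 => hx.notMem (h0 ▸ k.zero_mem)

theorem map_ne_zero (hx : LineInj k f x) : f x ≠ 0 := (_root_.map_ne_zero f).2 hx.ne_zero

theorem add_const (hx : LineInj k f x) {c : K} (hc : c ∈ k) : LineInj k f (x + c) := by
  refine ⟨fun d hd => ?_, fun d hd e he hde => ?_⟩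
  · rw [add_assoc]
    exact hx.1 _ (k.add_mem hc hd)
  · rw [add_assoc, add_assoc] at hde
    exact add_left_cancel (hx.2 _ (k.add_mem hc hd) _ (k.add_mem hc he) hde)

theorem map_add_ne (hx : LineInj k f x) {c : K} (hc : c ∈ k) (hc₀ : c ≠ 0) :
    f (x + c) ≠ f x := fun he =>
  hc₀ (hx.2 c hc 0 k.zero_mem (by simpa using he))

theorem map_add_ne_zero (hx : LineInj k f x) {c : K} (hc : c ∈ k) : f (x + c) ≠ 0 :=
  (hx.add_const hc).map_ne_zero

end LineInj

namespace IsDependenceHom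

variable {k : Subfield K} {f : K →*₀ G} {D : G → G → Prop} {x y u v w a b c d : K}

theorem map_neg (h : IsDependenceHom k f D) (x : K) : f (-x) = f x := by
  rw [← neg_one_mul, map_mul, h.map_eq_one (-1) (k.neg_mem k.one_mem) (by simp), one_mul]

theorem map_const_mul (h : IsDependenceHom k f D) (hc : c ∈ k) (hc₀ : c ≠ 0) (x : K) :
    f (c * x) = f x := by
  rw [map_mul, h.map_eq_one c hc hc₀, one_mul]

/-- Homogeneous form of `dep_add`: dividing by u moves the line through u and v to a line through 1.
-/
theorem dep_add_div (h : IsDependenceHom k f D) (hu : u ≠ 0) :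
    D (f (u + v) / f u) (f v / f u) := by
  rw [← map_div₀, ← map_div₀, add_div, div_self hu, add_comm]
  exact h.symm (h.dep_add (v / u) 1 k.one_mem)

theorem lineInj_const_mul (h : IsDependenceHom k f D) (hc : c ∈ k) (hc₀ : c ≠ 0)
    (hx : LineInj k f x) : LineInj k f (c * x) := by
  have key : ∀ d, f (c * x + d) = f (x + d / c) := fun d => by
    rw [← h.map_const_mul hc hc₀ (x + d / c)]
    congr 1
    field_simp
  refine ⟨fun d hd => ?_, fun d hd e he hde => ?_⟩
  · rw [key]
    exact hx.1 _ (k.div_mem hd hc)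
  · rw [key, key] at hde
    have := hx.2 _ (k.div_mem hd hc) _ (k.div_mem he hc) hde
    field_simp at this
    exact this

theorem lineInj_neg (h : IsDependenceHom k f D) (hx : LineInj k f x) : LineInj k f (-x) := by
  rw [← neg_one_mul]
  exact h.lineInj_const_mul (k.neg_mem k.one_mem) (by simp) hx

theorem map_inv_add (h : IsDependenceHom k f D) (hx : x ≠ 0) (hc : c ∈ k) (hc₀ : c ≠ 0) :
    f (x⁻¹ + c) = f (x + c⁻¹) / f x := by
  rw [← h.map_const_mul hc hc₀ (x + c⁻¹), ← map_div₀]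
  congr 1
  field_simp
  ring

/-- Multiplication by x carries the line through 1 and x⁻¹ to the line through 1 and x, and changes
the values of f by the constant factor f x. -/
theorem lineInj_inv (h : IsDependenceHom k f D) (hx : LineInj k f x) : LineInj k f x⁻¹ := by
  have h0 := hx.map_ne_zero
  have key : ∀ c ∈ k, c ≠ 0 → f (x⁻¹ + c) ≠ f x⁻¹ := by
    intro c hc hc₀ he
    rw [h.map_inv_add hx.ne_zero hc hc₀, map_inv₀, div_eq_iff h0, inv_mul_cancel₀ h0] at he
    exact hx.1 _ (k.inv_mem hc) he
  refine ⟨fun c hc => ?_, fun c hc d hd hcd => ?_⟩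
  · by_cases hc₀ : c = 0
    · simpa [hc₀] using hx.ne_one
    · rw [h.map_inv_add hx.ne_zero hc hc₀, Ne, div_eq_one_iff_eq h0]
      exact hx.map_add_ne (k.inv_mem hc) (inv_ne_zero hc₀)
  · by_cases hc₀ : c = 0
    · subst hc₀
      by_contra hd₀
      exact key d hd (Ne.symm hd₀) (by simpa using hcd.symm)
    · by_cases hd₀ : d = 0
      · subst hd₀
        exact absurd (by simpa using hcd) (key c hc hc₀)
      · rw [h.map_inv_add hx.ne_zero hc hc₀, h.map_inv_add hx.ne_zero hd hd₀,
          div_left_inj' h0] at hcd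
        exact inv_injective (hx.2 _ (k.inv_mem hc) _ (k.inv_mem hd) hcd)

/-- Independence is preserved under moving along an injective line through `1`. -/
theorem not_dep_add_const {g : G} (h : IsDependenceHom k f D) (hx : LineInj k f x) (hc : c ∈ k)
    (hxg : ¬ D (f x) g) : ¬ D (f (x + c)) g :=
  h.not_dep_of_dep hxg (h.dep_add x c hc) (hx.map_add_ne_zero hc) (hx.1 c hc)

/-- Write x + y = (x + c) + (y - c). If f (x + y) depended on f x, the quotient f (x + y) / f (x +
c) would depend both on f x and on f (y - c) / f (x + c), which are independent, so it would be 1.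
Then f (x + c) would be the same for all c in k. -/
theorem not_dep_add (h : IsDependenceHom k f D) (hx : LineInj k f x) (hy : LineInj k f y)
    (hxy : ¬ D (f x) (f y)) : ¬ D (f x) (f (x + y)) := by
  intro hd
  have hne : x + y ≠ 0 := fun h0 => hxy (by
    rw [eq_neg_of_add_eq_zero_right h0, h.map_neg]
    exact h.refl _)
  have key : ∀ c ∈ k, f (x + y) = f (x + c) := by
    intro c hc
    have hxc := hx.add_const hc
    have hyc := hy.add_const (k.neg_mem hc)
    have h1 : D (f (x + y) / f (x + c)) (f (y + -c) / f (x + c)) := by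
      have := h.dep_add_div (v := y + -c) hxc.ne_zero
      rwa [show x + c + (y + -c) = x + y by ring] at this
    have h2 : D (f x) (f (x + y) / f (x + c)) := h.div_right hd (h.dep_add x c hc)
    have h3 : ¬ D (f x) (f (y + -c) / f (x + c)) := fun h4 =>
      h.not_symm (h.not_dep_add_const hy (k.neg_mem hc) (h.not_symm hxy))
        (h.of_div_right hxc.map_ne_zero (h.dep_add x c hc) h4)
    have h4 := h.eq_one_of_dep h3 h2 (h.symm h1)
      (div_ne_zero ((map_ne_zero f).2 hne) hxc.map_ne_zero)
    exact (div_eq_one_iff_eq hxc.map_ne_zero).1 h4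
  exact hx.map_add_ne k.one_mem one_ne_zero
    ((key 1 k.one_mem).symm.trans (by simpa using key 0 k.zero_mem))

theorem not_dep_add' (h : IsDependenceHom k f D) (hx : LineInj k f x) (hy : LineInj k f y)
    (hxy : ¬ D (f x) (f y)) : ¬ D (f y) (f (x + y)) := by
  rw [add_comm]
  exact h.not_dep_add hy hx (h.not_symm hxy)

/-- If x + y + c and x + y + d have the same value, then f (x + c) / f y and f (x + d) / f y depend
on a common nontrivial element, hence on each other and on their quotient. That quotient is a
nontrivial element of the class of f x, which forces f y into this class. -/
theorem lineInj_add (h : IsDependenceHom k f D) (hx : LineInj k f x) (hy : LineInj k f y)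
    (hxy : ¬ D (f x) (f y)) : LineInj k f (x + y) := by
  have hstep : ∀ c ∈ k, ¬ D (f (x + c)) (f y) := fun c hc => h.not_dep_add_const hx hc hxy
  have hshift : ∀ c, x + y + c = x + c + y := fun c => by ring
  refine ⟨fun c hc => ?_, fun c hc d hd hcd => ?_⟩
  · rw [hshift]
    exact h.ne_one_right (h.not_dep_add (hx.add_const hc) hy (hstep c hc))
  · by_contra hne
    rw [hshift, hshift] at hcd
    have hc' := hx.add_const hc
    have hd' := hx.add_const hd
    have hy0 := hy.map_ne_zero
    have h1 := h.dep_add_div (u := y) (v := x + c) hy.ne_zero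
    have h2 := h.dep_add_div (u := y) (v := x + d) hy.ne_zero
    rw [add_comm y, hcd] at h1
    rw [add_comm y] at h2
    have hz := h.not_dep_add' hd' hy (hstep d hd)
    have h3 : D (f (x + c) / f y) (f (x + d) / f y) := by
      refine h.trans (div_ne_zero (h.ne_zero_right hz) hy0) ?_ (h.symm h1) h2
      rw [Ne, div_eq_one_iff_eq hy0]
      exact (h.ne hz).symm
    have h4 := h.div_right (h.refl _) h3
    rw [div_div_div_cancel_right₀ hy0] at h4
    have h5 : D (f (x + c)) (f (x + c) / f (x + d)) :=
      h.div_right (h.refl _) (h.trans hx.map_ne_zero hx.ne_one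
        (h.symm (h.dep_add x c hc)) (h.dep_add x d hd))
    have h6 : D (f (x + c)) (f (x + c) / f y) := by
      refine h.trans (div_ne_zero hc'.map_ne_zero hd'.map_ne_zero) ?_ h5 (h.symm h4)
      rw [Ne, div_eq_one_iff_eq hd'.map_ne_zero]
      exact fun he => hne (hx.2 c hc d hd he)
    exact hstep c hc (h.of_div_left hc'.map_ne_zero (h.refl _) h6)

/-- Factor xy + c = (x + c y⁻¹) y. The points x + c y⁻¹ have values independent of f y⁻¹, and two of
them differ by a nonzero multiple of y⁻¹, so `not_dep_add` makes their values independent and in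
particular distinct. -/
theorem lineInj_mul (h : IsDependenceHom k f D) (hx : LineInj k f x) (hy : LineInj k f y)
    (hxy : ¬ D (f x) (f y)) : LineInj k f (x * y) := by
  have hy0 := hy.map_ne_zero
  have hyi := h.lineInj_inv hy
  have hxyi : ¬ D (f x) (f y⁻¹) := by
    rw [map_inv₀]
    exact h.not_dep_inv_right hxy
  have hind : ∀ c ∈ k, LineInj k f (x + c * y⁻¹) ∧ ¬ D (f (x + c * y⁻¹)) (f y⁻¹) := by
    intro c hc
    by_cases hc₀ : c = 0
    · simpa [hc₀] using And.intro hx (by simpa using hxyi)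
    · have hcy := h.lineInj_const_mul hc hc₀ hyi
      have hf := h.map_const_mul hc hc₀ y⁻¹
      have hxcy : ¬ D (f x) (f (c * y⁻¹)) := by rwa [hf]
      refine ⟨h.lineInj_add hx hcy hxcy, h.not_symm ?_⟩
      have := h.not_dep_add' hx hcy hxcy
      rwa [hf] at this
  have hmul : ∀ c, f (x * y + c) = f (x + c * y⁻¹) * f y := fun c => by
    rw [← map_mul]
    congr 1
    field_simp [hy.ne_zero]
  refine ⟨fun c hc he => ?_, fun c hc d hd hcd => ?_⟩
  · rw [hmul] at he
    refine h.ne (hind c hc).2 ?_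
    rw [map_inv₀]
    exact eq_inv_of_mul_eq_one_left he
  · by_contra hne
    rw [hmul, hmul, mul_left_inj' hy0] at hcd
    have hdc : d - c ≠ 0 := sub_ne_zero.2 (Ne.symm hne)
    have hdk : d - c ∈ k := k.sub_mem hd hc
    have hf := h.map_const_mul hdk hdc y⁻¹
    have := h.not_dep_add (hind c hc).1 (h.lineInj_const_mul hdk hdc hyi)
      (by rw [hf]; exact (hind c hc).2)
    rw [show x + c * y⁻¹ + (d - c) * y⁻¹ = x + d * y⁻¹ by ring, ← hcd] at this
    exact this (h.refl _)

end IsDependenceHom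

theorem IsDependence.pow_right {D : G → G → Prop} (h : IsDependence D) {a b : G} (hab : D a b)
    (n : ℕ) : D a (b ^ n) := by
  induction n with
  | zero => simpa using h.one_right
  | succ n ih =>
    rw [pow_succ]
    exact h.mul_right ih hab

theorem ProdInj.ne_zero {k : Subfield K} {f : K →*₀ G} {x : K}
    (hx : ProdInj k f x) : x ≠ 0 := by
  obtain ⟨u, v, hu, hv, rfl⟩ := hx
  exact mul_ne_zero hu.ne_zero hv.ne_zero

namespace IsDependenceHom

variable {k : Subfield K} {f : K →*₀ G} {D : G → G → Prop} {x y u v w a b c d : K}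

/-! ### Elements in general position -/

theorem lineInj_pow_mul (h : IsDependenceHom k f D) (ha : LineInj k f a) (hb : LineInj k f b)
    (hab : ¬ D (f a) (f b)) (n : ℕ) :
    LineInj k f (a ^ n * b) ∧ ¬ D (f a) (f (a ^ n * b)) := by
  induction n with
  | zero => simpa using And.intro hb hab
  | succ n ih =>
    rw [pow_succ', mul_assoc]
    refine ⟨h.lineInj_mul ha ih.1 ih.2, fun hd => ih.2 ?_⟩
    have := h.div_right hd (h.refl _)
    rwa [map_mul, mul_div_cancel_left₀ _ ha.map_ne_zero] at this

theorem dep_of_dep_pow_mul {g α : G} (h : IsDependenceHom k f D) (ha : LineInj k f a)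
    (hb : b ≠ 0) (hα : α ≠ 0) {m n : ℕ} (hmn : m < n) (hm : D g (f (a ^ m * b) / α))
    (hn : D g (f (a ^ n * b) / α)) : D g (f a) := by
  have ha0 := ha.map_ne_zero
  have hb0 : f b ≠ 0 := (map_ne_zero f).2 hb
  have hd := h.div_right hn hm
  have he : f (a ^ n * b) / α / (f (a ^ m * b) / α) = f a ^ (n - m) := by
    rw [div_div_div_cancel_right₀ hα, map_mul, map_mul, mul_div_mul_right _ _ hb0, map_pow,
      map_pow, pow_sub₀ _ ha0 hmn.le, div_eq_mul_inv]
  rw [he] at hd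
  exact h.trans (pow_ne_zero _ ha0) (h.pow_ne_one ha0 ha.ne_one (by omega)) hd
    (h.symm (h.pow_right (h.refl _) _))

/-- The candidates are the a ^ n * b. Each pair excludes at most one n: two bad exponents would make
a nontrivial power of f a, hence f a itself, dependent on the second component. The first component
is then 1, and f (a ^ n * b) would depend on f a. -/
theorem exists_pow_mul_not_dep (h : IsDependenceHom k f D) (ha : LineInj k f a)
    (hb : LineInj k f b) (hab : ¬ D (f a) (f b)) (s : Finset (G × G))
    (hs : ∀ p ∈ s, p.1 ≠ 0 ∧ (D p.2 (f a) → p.1 = 1 ∧ p.2 ≠ 0 ∧ p.2 ≠ 1)) :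
    ∃ w, LineInj k f w ∧ ∀ p ∈ s, ¬ D (f w / p.1) p.2 := by
  have hfin : (⋃ p ∈ s, {n : ℕ | D p.2 (f (a ^ n * b) / p.1)}).Finite := by
    refine s.finite_toSet.biUnion fun p hp => Set.Subsingleton.finite ?_
    obtain ⟨h0, h1⟩ := hs p hp
    have key : ∀ m n : ℕ, m < n → D p.2 (f (a ^ m * b) / p.1) →
        D p.2 (f (a ^ n * b) / p.1) → False := by
      intro m n hmn hm hn
      have hd := h.dep_of_dep_pow_mul ha hb.ne_zero h0 hmn hm hn
      obtain ⟨h2, h3, h4⟩ := h1 hd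
      rw [h2, div_one] at hm
      exact (h.lineInj_pow_mul ha hb hab m).2 (h.trans h3 h4 (h.symm hd) hm)
    intro m hm n hn
    rcases lt_trichotomy m n with hmn | hmn | hmn
    · exact (key m n hmn hm hn).elim
    · exact hmn
    · exact (key n m hmn hn hm).elim
  obtain ⟨n, hn⟩ := hfin.exists_notMem
  simp only [Set.mem_iUnion, not_exists, Set.mem_ofPred_eq] at hn
  exact ⟨a ^ n * b, (h.lineInj_pow_mul ha hb hab n).1, fun p hp hd => hn p hp (h.symm hd)⟩

theorem exists_not_dep (h : IsDependenceHom k f D) (s : Finset G)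
    (hs : ∀ g ∈ s, g ≠ 0 ∧ g ≠ 1) : ∃ w, LineInj k f w ∧ ∀ g ∈ s, ¬ D (f w) g := by
  classical
  obtain ⟨a, b, ha, hb, hab⟩ := h.exists_pair
  obtain ⟨w, hw, hws⟩ := h.exists_pow_mul_not_dep ha hb hab (s.image fun g => (1, g)) (by
    intro p hp
    obtain ⟨g, hg, rfl⟩ := Finset.mem_image.1 hp
    exact ⟨one_ne_zero, fun _ => ⟨rfl, hs g hg⟩⟩)
  refine ⟨w, hw, fun g hg => ?_⟩
  simpa using hws (1, g) (Finset.mem_image.2 ⟨g, hg, rfl⟩)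

theorem exists_not_dep_div (h : IsDependenceHom k f D) (s : Finset (G × G))
    (hs : ∀ p ∈ s, p.1 ≠ 0 ∧ p.2 ≠ 0 ∧ p.2 ≠ 1) :
    ∃ w, LineInj k f w ∧ ∀ p ∈ s, ¬ D (f w / p.1) p.2 := by
  classical
  obtain ⟨a, ha, has⟩ := h.exists_not_dep (s.image Prod.snd) (by
    intro g hg
    obtain ⟨p, hp, rfl⟩ := Finset.mem_image.1 hg
    exact (hs p hp).2)
  obtain ⟨b, hb, hba⟩ := h.exists_not_dep {f a} (by
    simpa using And.intro ha.ne_zero ha.ne_one)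
  -- As f a is independent of every second component, the exceptional case never occurs and the
  -- first components may be arbitrary nonzero elements.
  refine h.exists_pow_mul_not_dep ha hb (h.not_symm (hba _ (by simp))) s fun p hp =>
    ⟨(hs p hp).1, fun hd => ?_⟩
  exact absurd (h.symm hd) (has _ (Finset.mem_image.2 ⟨p, hp, rfl⟩))

theorem exists_not_dep_one {g : G} (h : IsDependenceHom k f D) (hg₀ : g ≠ 0) (hg : g ≠ 1) :
    ∃ w, LineInj k f w ∧ ¬ D (f w) g := by
  obtain ⟨w, hw, hws⟩ := h.exists_not_dep {g} (by simpa using And.intro hg₀ hg)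
  exact ⟨w, hw, hws g (by simp)⟩

/-! ### The group of products -/

theorem not_dep_mul_inv {g : G} (h : IsDependenceHom k f D) (hy : f y ≠ 0)
    (hyg : D (f y) g) (hg₀ : g ≠ 0) (hg : g ≠ 1) (hwy : ¬ D (f w) (f y)) :
    ¬ D (f (y * w⁻¹)) g := by
  intro hd
  refine hwy (h.symm (h.of_div_left hy (h.refl _) ?_))
  rw [← map_div₀, div_eq_mul_inv]
  exact h.trans hg₀ hg hyg (h.symm hd)

theorem prodInj_of_lineInj (h : IsDependenceHom k f D) (hx : LineInj k f x) : ProdInj k f x := by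
  obtain ⟨w, hw, hwx⟩ := h.exists_not_dep_one hx.map_ne_zero hx.ne_one
  refine ⟨x * w, w⁻¹, h.lineInj_mul hx hw (h.not_symm hwx), h.lineInj_inv hw, ?_⟩
  field_simp [hw.ne_zero]

/-- Three factors reduce to two. If u and v have dependent values, a general w regroups the product
as (x w)(u w⁻¹ v), where every multiplication needed is one of independent elements. -/
theorem prodInj_lineInj_mul (h : IsDependenceHom k f D) (hx : LineInj k f x)
    (hy : ProdInj k f y) : ProdInj k f (x * y) := by
  obtain ⟨u, v, hu, hv, rfl⟩ := hy
  classical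
  by_cases huv : D (f u) (f v)
  · obtain ⟨w, hw, hws⟩ := h.exists_not_dep {f x, f u} (by
      simp [hx.ne_zero, hx.ne_one, hu.ne_zero, hu.ne_one])
    have hwx := hws (f x) (by simp)
    have hwu := hws (f u) (by simp)
    refine ⟨x * w, u * w⁻¹ * v, h.lineInj_mul hx hw (h.not_symm hwx), ?_, ?_⟩
    · refine h.lineInj_mul (h.lineInj_mul hu (h.lineInj_inv hw) ?_) hv
        (h.not_dep_mul_inv hu.map_ne_zero huv hv.map_ne_zero hv.ne_one hwu)
      rw [map_inv₀]
      exact h.not_dep_inv_right (h.not_symm hwu)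
    · field_simp [hw.ne_zero]
  · exact ⟨x, u * v, hx, h.lineInj_mul hu hv huv, rfl⟩

theorem prodInj_mul (h : IsDependenceHom k f D) (hx : ProdInj k f x) (hy : ProdInj k f y) :
    ProdInj k f (x * y) := by
  obtain ⟨u, v, hu, hv, rfl⟩ := hx
  rw [mul_assoc]
  exact h.prodInj_lineInj_mul hu (h.prodInj_lineInj_mul hv hy)

theorem prodInj_inv (h : IsDependenceHom k f D) (hx : ProdInj k f x) : ProdInj k f x⁻¹ := by
  obtain ⟨u, v, hu, hv, rfl⟩ := hx
  exact ⟨u⁻¹, v⁻¹, h.lineInj_inv hu, h.lineInj_inv hv, mul_inv u v⟩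

theorem prodInj_div (h : IsDependenceHom k f D) (hx : ProdInj k f x) (hy : ProdInj k f y) :
    ProdInj k f (x / y) := by
  rw [div_eq_mul_inv]
  exact h.prodInj_mul hx (h.prodInj_inv hy)

theorem prodInj_neg (h : IsDependenceHom k f D) (hx : ProdInj k f x) : ProdInj k f (-x) := by
  obtain ⟨u, v, hu, hv, rfl⟩ := hx
  exact ⟨-u, v, h.lineInj_neg hu, hv, (neg_mul u v).symm⟩

theorem prodInj_one (h : IsDependenceHom k f D) : ProdInj k f 1 := by
  obtain ⟨a, -, ha, -, -⟩ := h.exists_pair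
  exact ⟨a, a⁻¹, ha, h.lineInj_inv ha, (mul_inv_cancel₀ ha.ne_zero).symm⟩

/-- On the group of products, the elements outside the kernel lie on injective lines. -/
theorem lineInj_of_prodInj (h : IsDependenceHom k f D) (hx : ProdInj k f x) (hx₁ : f x ≠ 1) :
    LineInj k f x := by
  obtain ⟨u, v, hu, hv, rfl⟩ := hx
  by_cases huv : D (f u) (f v)
  · obtain ⟨w, hw, hwu⟩ := h.exists_not_dep_one hu.map_ne_zero hu.ne_one
    have hwi : ¬ D (f w⁻¹) (f u) := by
      rw [map_inv₀]
      exact h.not_symm (h.not_dep_inv_right (h.not_symm hwu))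
    have h1 := h.lineInj_mul hu hw (h.not_symm hwu)
    have h2 : LineInj k f (w⁻¹ * v) := h.lineInj_mul (h.lineInj_inv hw) hv fun hd =>
      hwi (h.trans hv.map_ne_zero hv.ne_one hd (h.symm huv))
    -- The new factors are independent: otherwise f (u * w) would depend on f (u * v), a nontrivial
    -- element of the class of f u, and f w would lie in that class.
    have he : u * v = (u * w) * (w⁻¹ * v) := by field_simp [hw.ne_zero]
    rw [he]
    refine h.lineInj_mul h1 h2 fun hd => ?_
    have h3 := h.mul_right (h.refl (f (u * w))) hd
    rw [← map_mul, ← he] at h3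
    have h4 : D (f u) (f (u * v)) := by
      rw [map_mul]
      exact h.mul_right (h.refl _) huv
    have h5 : D (f u) (f (u * w)) :=
      h.trans ((map_ne_zero f).2 (mul_ne_zero hu.ne_zero hv.ne_zero)) hx₁ h4 (h.symm h3)
    have h6 := h.div_right h5 (h.refl _)
    rw [map_mul, mul_div_cancel_left₀ _ hu.map_ne_zero] at h6
    exact hwu (h.symm h6)
  · exact h.lineInj_mul hu hv huv

theorem lineInj_div (h : IsDependenceHom k f D) (hx : ProdInj k f x) (hy : ProdInj k f y)
    (hxy : f x ≠ f y) : LineInj k f (x / y) := by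
  refine h.lineInj_of_prodInj (h.prodInj_div hx hy) ?_
  rwa [map_div₀, Ne, div_eq_one_iff_eq ((map_ne_zero f).2 (hy.ne_zero))]

/-- In x + y = (x / y + 1) y the quotient x / y lies on an injective line, and so does its translate
by 1. -/
theorem prodInj_add (h : IsDependenceHom k f D) (hx : ProdInj k f x) (hy : ProdInj k f y)
    (hxy : f x ≠ f y) : ProdInj k f (x + y) := by
  have hy0 := hy.ne_zero
  have := h.prodInj_mul (h.prodInj_of_lineInj ((h.lineInj_div hx hy hxy).add_const k.one_mem)) hy
  rwa [add_mul, div_mul_cancel₀ _ hy0, one_mul] at this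

theorem prodInj_sub (h : IsDependenceHom k f D) (hx : ProdInj k f x) (hy : ProdInj k f y)
    (hxy : f x ≠ f y) : ProdInj k f (x - y) := by
  rw [sub_eq_add_neg]
  exact h.prodInj_add hx (h.prodInj_neg hy) (by rwa [h.map_neg])

theorem map_add_ne_right (h : IsDependenceHom k f D) (hx : ProdInj k f x) (hy : ProdInj k f y)
    (hxy : f x ≠ f y) : f (x + y) ≠ f y := by
  have hy0 := hy.ne_zero
  have := (h.lineInj_div hx hy hxy).1 1 k.one_mem
  rwa [show x / y + 1 = (x + y) / y by field_simp, map_div₀, Ne,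
    div_eq_one_iff_eq ((map_ne_zero f).2 hy0)] at this

theorem map_add_ne_left (h : IsDependenceHom k f D) (hx : ProdInj k f x) (hy : ProdInj k f y)
    (hxy : f x ≠ f y) : f (x + y) ≠ f x := by
  rw [add_comm]
  exact h.map_add_ne_right hy hx hxy.symm

/-! ### Lines that are not injective -/

/-- Write x + w = (x + c) + (w - c). If f (x + w) / f x were nontrivial, it would make f w / f x and
f (w - c) / f x dependent. Their quotient is a nontrivial element of the class of f w, so f x would
lie in that class. -/
theorem map_add_lineInj_of_map_eq (h : IsDependenceHom k f D) (hx₀ : x ≠ 0)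
    (hc : c ∈ k) (hc₀ : c ≠ 0) (hxc : f (x + c) = f x) (hw : LineInj k f w)
    (hwx : ¬ D (f w) (f x)) : f (x + w) = f x := by
  have hfx : f x ≠ 0 := (map_ne_zero f).2 hx₀
  have hxc₀ : x + c ≠ 0 := (map_ne_zero f).1 (hxc ▸ hfx)
  by_contra hne
  have hxw : x + w ≠ 0 := fun h0 => hwx (by
    rw [eq_neg_of_add_eq_zero_right h0, h.map_neg]
    exact h.refl _)
  have h1 := h.dep_add_div (v := w) hx₀
  have h2 := h.dep_add_div (v := w + -c) hxc₀
  rw [show x + c + (w + -c) = x + w by ring, hxc] at h2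
  have ht₀ : f (x + w) / f x ≠ 0 := div_ne_zero ((map_ne_zero f).2 hxw) hfx
  have ht : f (x + w) / f x ≠ 1 := by rwa [Ne, div_eq_one_iff_eq hfx]
  have h3 := h.div_right (h.refl _) (h.trans ht₀ ht (h.symm h1) h2)
  rw [div_div_div_cancel_right₀ hfx] at h3
  have hwc := hw.add_const (k.neg_mem hc)
  have h4 : D (f w) (f w / f (w + -c)) := h.div_right (h.refl _) (h.dep_add w _ (k.neg_mem hc))
  have h5 : D (f w) (f w / f x) := by
    refine h.trans (div_ne_zero hw.map_ne_zero hwc.map_ne_zero) ?_ h4 (h.symm h3)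
    rw [Ne, div_eq_one_iff_eq hwc.map_ne_zero]
    exact (hw.map_add_ne (k.neg_mem hc) (neg_ne_zero.2 hc₀)).symm
  exact hwx (h.of_div_left hw.map_ne_zero (h.refl _) h5)

/-- If a nontrivial value is attained twice on a line, outside the point `1`, then it is
attained everywhere on the line, except at `1`. -/
theorem map_add_const_of_map_eq (h : IsDependenceHom k f D) (hx₁ : f x ≠ 1) (hx₀ : x ≠ 0)
    (hc : c ∈ k) (hc₀ : c ≠ 0) (hxc : f (x + c) = f x) (hd : d ∈ k) : f (x + d) = f x := by
  have hfx : f x ≠ 0 := (map_ne_zero f).2 hx₀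
  have hxk : x ∉ k := fun hk => hx₁ (h.map_eq_one x hk hx₀)
  have hxd : x + d ≠ 0 := fun h0 => hxk (by
    rw [eq_neg_of_add_eq_zero_left h0]
    exact k.neg_mem hd)
  have hfd : f (x + d) ≠ 0 := (map_ne_zero f).2 hxd
  obtain ⟨w, hw, hwx⟩ := h.exists_not_dep_one hfx hx₁
  have hgen : ∀ r, LineInj k f r → ¬ D (f r) (f x) → f (x + d + r) = f x := fun r hr hrx => by
    rw [show x + d + r = x + (r + d) by ring]
    exact h.map_add_lineInj_of_map_eq hx₀ hc hc₀ hxc (hr.add_const hd)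
      (h.not_dep_add_const hr hd hrx)
  by_cases h1 : f (x + d) = 1
  -- After inversion of t = x + d, which has value 1, the value f x is again taken at two points of
  -- the line through 1 and t⁻¹. So f (t⁻¹ + w) = f x, while also f (t + w⁻¹) = f x. Comparing the
  -- two gives f w = 1.
  · exfalso
    set t := x + d with ht
    have hd₀ : -d ≠ 0 := fun h0 => hx₁ (by
      rw [neg_eq_zero] at h0
      rwa [ht, h0, add_zero] at h1)
    have hcd : c - d ∈ k := k.sub_mem hc hd
    have hcd₀ : c - d ≠ 0 := fun h0 => hx₁ (by rw [← hxc, sub_eq_zero.1 h0, ← ht, h1])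
    have hdk : -d ∈ k := k.neg_mem hd
    have e1 : f (t⁻¹ + (-d)⁻¹) = f x := by
      rw [h.map_inv_add hxd (k.inv_mem hdk) (inv_ne_zero hd₀), h1, div_one, inv_inv]
      congr 1
      rw [ht]; ring
    have e2 : f (t⁻¹ + (c - d)⁻¹) = f x := by
      rw [h.map_inv_add hxd (k.inv_mem hcd) (inv_ne_zero hcd₀), h1, div_one, inv_inv, ← hxc]
      congr 1
      rw [ht]; ring
    have e3 : f (t⁻¹ + w) = f x := by
      have := h.map_add_lineInj_of_map_eq (x := t⁻¹ + (-d)⁻¹) (c := (c - d)⁻¹ - (-d)⁻¹)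
        (w := w + -(-d)⁻¹) ((map_ne_zero f).1 (by rwa [e1]))
        (k.sub_mem (k.inv_mem hcd) (k.inv_mem hdk))
        (fun h0 => hc₀ (by simpa [sub_eq_add_neg] using inv_injective (sub_eq_zero.1 h0)))
        (by rw [e1, ← e2]; congr 1; ring) (hw.add_const (k.neg_mem (k.inv_mem hdk)))
        (by rw [e1]; exact h.not_dep_add_const hw (k.neg_mem (k.inv_mem hdk)) hwx)
      rw [e1] at this
      rw [← this]
      congr 1
      ring
    have e4 : f (t + w⁻¹) = f x := hgen _ (h.lineInj_inv hw) (by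
      rw [map_inv₀]
      exact h.not_symm (h.not_dep_inv_right (h.not_symm hwx)))
    have e5 : t⁻¹ + w = t⁻¹ * w * (t + w⁻¹) := by
      field_simp [hw.ne_zero]
      ring
    rw [e5, map_mul, map_mul, e4, map_inv₀, h1, inv_one, one_mul] at e3
    exact hw.ne_one (mul_right_cancel₀ hfx (e3.trans (one_mul _).symm))
  · have h2 := h.dep_add_div (v := w) hxd
    rw [hgen w hw hwx] at h2
    have hxd' : D (f x) (f (x + d)) := h.dep_add x d hd
    have h3 : D (f x) (f x / f (x + d)) := h.div_right (h.refl _) hxd'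
    have h4 : ¬ D (f x) (f w / f (x + d)) := fun hd' =>
      hwx (h.symm (h.of_div_right hfd hxd' hd'))
    exact ((div_eq_one_iff_eq hfd).1
      (h.eq_one_of_dep h4 h3 (h.symm h2) (div_ne_zero hfx hfd))).symm

/-- On a line through `1` on which `f` is neither injective nor constant on `{1, x}`, all other
points have the value at `x`, or all of them have the value at `1`. -/
theorem map_add_const_of_not_lineInj (h : IsDependenceHom k f D) (hx₀ : x ≠ 0) (hx₁ : f x ≠ 1)
    (hx : ¬ LineInj k f x) (hc : c ∈ k) (hc₀ : c ≠ 0) :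
    f (x + c) = f x ∨ f (x + c) = 1 := by
  have hfx : f x ≠ 0 := (map_ne_zero f).2 hx₀
  have hxk : x ∉ k := fun hk => hx₁ (h.map_eq_one x hk hx₀)
  by_cases hA : ∃ d ∈ k, f (x + d) = 1
  · right
    obtain ⟨d, hd, hd1⟩ := hA
    have hd₀ : d ≠ 0 := by
      rintro rfl
      exact hx₁ (by simpa using hd1)
    have hi₁ : f x⁻¹ ≠ 1 := by simpa using hx₁
    -- Inversion exchanges the roles of the points 1 and x, so a second point of value 1 becomes a
    -- repetition of the value at x⁻¹.
    have e1 : f (x⁻¹ + d⁻¹) = f x⁻¹ := by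
      rw [h.map_inv_add hx₀ (k.inv_mem hd) (inv_ne_zero hd₀), inv_inv, hd1, map_inv₀, one_div]
    have e2 := h.map_add_const_of_map_eq hi₁ (inv_ne_zero hx₀) (k.inv_mem hd)
      (inv_ne_zero hd₀) e1 (k.inv_mem hc)
    rw [h.map_inv_add hx₀ (k.inv_mem hc) (inv_ne_zero hc₀), inv_inv, map_inv₀,
      div_eq_iff hfx, inv_mul_cancel₀ hfx] at e2
    exact e2
  · left
    push Not at hA
    have hB : ∃ a ∈ k, ∃ b ∈ k, f (x + a) = f (x + b) ∧ a ≠ b := by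
      by_contra hB
      push Not at hB
      exact hx ⟨hA, hB⟩
    obtain ⟨a, ha, b, hb, hab, hne⟩ := hB
    have hxa : x + a ≠ 0 := fun h0 => hxk (by
      rw [eq_neg_of_add_eq_zero_left h0]
      exact k.neg_mem ha)
    have key : ∀ e ∈ k, f (x + e) = f (x + a) := by
      intro e he
      have := h.map_add_const_of_map_eq (hA a ha) hxa (k.sub_mem hb ha)
        (sub_ne_zero.2 hne.symm) (by rw [hab]; congr 1; ring) (k.sub_mem he ha)
      rw [← this]
      congr 1
      ring
    rw [key c hc, ← key 0 k.zero_mem, add_zero]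

/-- Three collinear points with distinct values lie on an injective line. -/
theorem lineInj_div_of_ne (h : IsDependenceHom k f D) (hu : u ≠ 0) (hv : v ≠ 0)
    (huv : f u ≠ f v) (h₁ : f (u + v) ≠ f u) (h₂ : f (u + v) ≠ f v) : LineInj k f (u / v) := by
  by_contra hn
  have hfv : f v ≠ 0 := (map_ne_zero f).2 hv
  have he : u / v + 1 = (u + v) / v := by field_simp
  rcases h.map_add_const_of_not_lineInj (div_ne_zero hu hv)
    (by rwa [map_div₀, Ne, div_eq_one_iff_eq hfv]) hn k.one_mem one_ne_zero with h3 | h3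
  · rw [he, map_div₀, map_div₀, div_left_inj' hfv] at h3
    exact h₁ h3
  · rw [he, map_div₀, div_eq_one_iff_eq hfv] at h3
    exact h₂ h3

end IsDependenceHom

/-! ### Infinitesimals and the valuation ring -/

/-- The nonzero elements outside the group of products that are infinitesimal with respect to it:
they do not change the values of `f` on this group. -/
structure IsSmall (k : Subfield K) (f : K →*₀ G) (x : K) : Prop where
  ne_zero : x ≠ 0
  not_prodInj : ¬ ProdInj k f x
  map_add : ∀ w, ProdInj k f w → f w ≠ f x → f (w + x) = f w

namespace IsDependenceHom

variable {k : Subfield K} {f : K →*₀ G} {D : G → G → Prop} {x y z w w₁ w₂ : K}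

theorem map_add_eq_or (h : IsDependenceHom k f D) (hx₀ : x ≠ 0) (hx : ¬ ProdInj k f x)
    (hw : ProdInj k f w) (hwx : f w ≠ f x) : f (w + x) = f w ∨ f (w + x) = f x := by
  by_contra! hn
  have := h.prodInj_of_lineInj (h.lineInj_div_of_ne hw.ne_zero hx₀ hwx hn.1 hn.2)
  refine hx ?_
  have h2 := h.prodInj_div hw this
  rwa [div_div_cancel₀ hw.ne_zero] at h2

/-- Three collinear points with distinct values, one of which belongs to the group of products. -/
theorem prodInj_of_ne (h : IsDependenceHom k f D) (hx : x ≠ 0) (hw : ProdInj k f w)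
    (h₁ : f x ≠ f w) (h₂ : f (x + w) ≠ f x) (h₃ : f (x + w) ≠ f w) :
    ProdInj k f x := by
  have := h.prodInj_mul
    (h.prodInj_of_lineInj (h.lineInj_div_of_ne hx hw.ne_zero h₁ h₂ h₃)) hw
  rwa [div_mul_cancel₀ _ hw.ne_zero] at this

/-- Suppose f (w₂ + x) = f x, and consider w₁ + w₂ + x, whose value is f (w₁ + w₂) or f x. In the
first case the decomposition (w₂ + x) + w₁, in the second (w₁ + x) + w₂, has three distinct values.
By `prodInj_of_ne` the bracket lies in the group of products, and then so does x. -/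
theorem map_add_eq_of_map_add_eq (h : IsDependenceHom k f D) (hx₀ : x ≠ 0)
    (hx : ¬ ProdInj k f x) (hw₁ : ProdInj k f w₁) (hw₂ : ProdInj k f w₂) (h₁₂ : f w₁ ≠ f w₂)
    (h₁ : f w₁ ≠ f x) (h₂ : f w₂ ≠ f x) (hs : f (w₁ + w₂) ≠ f x) (he₁ : f (w₁ + x) = f w₁) :
    f (w₂ + x) = f w₂ := by
  have hS := h.prodInj_add hw₁ hw₂ h₁₂
  have hs₁ := h.map_add_ne_left hw₁ hw₂ h₁₂
  have hs₂ := h.map_add_ne_right hw₁ hw₂ h₁₂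
  have hfx : f x ≠ 0 := (map_ne_zero f).2 hx₀
  rcases h.map_add_eq_or hx₀ hx hw₂ h₂ with he₂ | he₂
  · exact he₂
  exfalso
  rcases h.map_add_eq_or hx₀ hx hS hs with he | he
  · have h0 : w₂ + x ≠ 0 := (map_ne_zero f).1 (by rwa [he₂])
    have e : w₂ + x + w₁ = w₁ + w₂ + x := by ring
    have hp : ProdInj k f (w₂ + x) := h.prodInj_of_ne h0 hw₁ (by rw [he₂]; exact h₁.symm)
      (by rw [e, he, he₂]; exact hs) (by rw [e, he]; exact hs₁)
    have := h.prodInj_sub hp hw₂ (by rw [he₂]; exact h₂.symm)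
    rw [add_sub_cancel_left] at this
    exact hx this
  · have h0 : w₁ + x ≠ 0 := (map_ne_zero f).1 (by
      rw [he₁]
      exact (map_ne_zero f).2 hw₁.ne_zero)
    have e : w₁ + x + w₂ = w₁ + w₂ + x := by ring
    have hp : ProdInj k f (w₁ + x) := h.prodInj_of_ne h0 hw₂ (by rwa [he₁])
      (by rw [e, he, he₁]; exact h₁.symm) (by rw [e, he]; exact h₂.symm)
    have hq := h.prodInj_add hp hw₂ (by rwa [he₁])
    have := h.prodInj_sub hq hS (by rw [e, he]; exact hs.symm)
    rw [e, add_sub_cancel_left] at this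
    exact hx this

theorem map_add_ne_of_not_dep {g : G} (h : IsDependenceHom k f D)
    (hy : ProdInj k f y) (hg : ¬ D (f w / f y) (g / f y)) :
    f y ≠ f w ∧ f w ≠ g ∧ f (y + w) ≠ g := by
  have hfy : f y ≠ 0 := (map_ne_zero f).2 hy.ne_zero
  have hwy : f w ≠ f y := fun he => h.ne_one_left hg ((div_eq_one_iff_eq hfy).2 he)
  refine ⟨hwy.symm, fun he => hg (he ▸ h.refl _), fun he => hg ?_⟩
  have := h.dep_add (w / y) 1 k.one_mem
  rwa [show w / y + 1 = (y + w) / y by field_simp [hy.ne_zero]; ring, map_div₀, map_div₀,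
    he] at this

/-- An element outside the group of products has the same position relative to all elements of
this group. -/
theorem map_add_eq_of_prodInj (h : IsDependenceHom k f D) (hx₀ : x ≠ 0)
    (hx : ¬ ProdInj k f x) (hw₁ : ProdInj k f w₁) (hw₂ : ProdInj k f w₂)
    (h₁ : f w₁ ≠ f x) (h₂ : f w₂ ≠ f x) (he₁ : f (w₁ + x) = f w₁) : f (w₂ + x) = f w₂ := by
  classical
  have hfx : f x ≠ 0 := (map_ne_zero f).2 hx₀
  have hf₁ : f w₁ ≠ 0 := (map_ne_zero f).2 hw₁.ne_zero
  have hf₂ : f w₂ ≠ 0 := (map_ne_zero f).2 hw₂.ne_zero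
  -- The values at w₁ and w₂ may coincide, so the comparison passes through a w in general position
  -- to both.
  obtain ⟨w, hw, hws⟩ := h.exists_not_dep_div {(f w₁, f x / f w₁), (f w₂, f x / f w₂)} (by
    simp only [Finset.mem_insert, Finset.mem_singleton]
    rintro p (rfl | rfl)
    · exact ⟨hf₁, div_ne_zero hfx hf₁, fun he => h₁ ((div_eq_one_iff_eq hf₁).1 he).symm⟩
    · exact ⟨hf₂, div_ne_zero hfx hf₂, fun he => h₂ ((div_eq_one_iff_eq hf₂).1 he).symm⟩)
  have hwP := h.prodInj_of_lineInj hw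
  obtain ⟨a₁, b₁, c₁⟩ := h.map_add_ne_of_not_dep hw₁ (hws (f w₁, f x / f w₁) (by simp))
  obtain ⟨a₂, -, c₂⟩ := h.map_add_ne_of_not_dep hw₂ (hws (f w₂, f x / f w₂) (by simp))
  have he := h.map_add_eq_of_map_add_eq hx₀ hx hw₁ hwP a₁ h₁ b₁ c₁ he₁
  exact h.map_add_eq_of_map_add_eq hx₀ hx hwP hw₂ a₂.symm b₁ h₂ (by rwa [add_comm]) he

/-- If x is not infinitesimal, it dominates: f (w + x) = f x for all admissible w. The identity w +
x⁻¹ = (w⁻¹ + x)(w / x) turns this into the condition on x⁻¹. -/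
theorem isSmall_or_isSmall_inv (h : IsDependenceHom k f D) (hx₀ : x ≠ 0)
    (hx : ¬ ProdInj k f x) : IsSmall k f x ∨ IsSmall k f x⁻¹ := by
  have hfx : f x ≠ 0 := (map_ne_zero f).2 hx₀
  by_cases hs : ∃ w, ProdInj k f w ∧ f w ≠ f x ∧ f (w + x) = f w
  · obtain ⟨w, hw, hwx, he⟩ := hs
    exact Or.inl ⟨hx₀, hx, fun w' hw' hwx' => h.map_add_eq_of_prodInj hx₀ hx hw hw' hwx hwx' he⟩
  · push Not at hs
    refine Or.inr ⟨inv_ne_zero hx₀, fun hi => hx (by simpa using h.prodInj_inv hi),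
      fun w hw hwx => ?_⟩
    have hfw : f w ≠ 0 := (map_ne_zero f).2 hw.ne_zero
    have hwx' : f w⁻¹ ≠ f x := fun he => hwx (by rw [map_inv₀, ← he, map_inv₀, inv_inv])
    have e := (h.map_add_eq_or hx₀ hx (h.prodInj_inv hw) hwx').resolve_left
      (hs _ (h.prodInj_inv hw) hwx')
    rw [show w + x⁻¹ = (w⁻¹ + x) * (w / x) by field_simp [hw.ne_zero]; ring, map_mul, e,
      map_div₀, mul_div_cancel₀ _ hfx]

theorem not_isSmall_inv (h : IsDependenceHom k f D) (hx : IsSmall k f x) :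
    ¬ IsSmall k f x⁻¹ := by
  intro hi
  have hfx : f x ≠ 0 := (map_ne_zero f).2 hx.ne_zero
  obtain ⟨w, hw, hwx⟩ : ∃ w, LineInj k f w ∧ f w ≠ f x := by
    by_cases h1 : f x = 1
    · obtain ⟨a, -, ha, -, -⟩ := h.exists_pair
      exact ⟨a, ha, h1 ▸ ha.ne_one⟩
    · obtain ⟨w, hw, hwx⟩ := h.exists_not_dep_one hfx h1
      exact ⟨w, hw, h.ne hwx⟩
  have hwP := h.prodInj_of_lineInj hw
  have e1 := hx.map_add w hwP hwx
  have e2 := hi.map_add w⁻¹ (h.prodInj_inv hwP) (by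
    rw [map_inv₀, map_inv₀]
    exact fun he => hwx (inv_injective he))
  rw [show w⁻¹ + x⁻¹ = (w + x) / (w * x) by field_simp [hw.ne_zero, hx.ne_zero]; ring,
    map_div₀, e1, map_mul, map_inv₀, div_mul_cancel_left₀ hw.map_ne_zero] at e2
  exact hwx (inv_injective e2).symm

theorem isSmall_mul (h : IsDependenceHom k f D) (hx : IsSmall k f x) (hy : ProdInj k f y) :
    IsSmall k f (x * y) := by
  have hfy : f y ≠ 0 := (map_ne_zero f).2 hy.ne_zero
  refine ⟨mul_ne_zero hx.ne_zero hy.ne_zero, fun hp => hx.not_prodInj ?_, fun w hw hwx => ?_⟩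
  · have := h.prodInj_div hp hy
    rwa [mul_div_cancel_right₀ _ hy.ne_zero] at this
  · have := hx.map_add (w / y) (h.prodInj_div hw hy) (by
      rwa [map_div₀, Ne, div_eq_iff hfy, ← map_mul])
    rw [show w + x * y = (w / y + x) * y by field_simp [hy.ne_zero], map_mul, this, map_div₀,
      div_mul_cancel₀ _ hfy]

/-- For a general v, the points w + x, v and w + x + v have the same values as w, v and w + v, which
are distinct, so `prodInj_of_ne` applies. -/
theorem prodInj_add_isSmall_of_ne (h : IsDependenceHom k f D) (hx : IsSmall k f x)
    (hw : ProdInj k f w) (hwx : f w ≠ f x) : ProdInj k f (w + x) := by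
  have hfx : f x ≠ 0 := (map_ne_zero f).2 hx.ne_zero
  have hfw : f w ≠ 0 := (map_ne_zero f).2 hw.ne_zero
  obtain ⟨v, hv, hvs⟩ := h.exists_not_dep_div {(f w, f x / f w)} (by
    simp only [Finset.mem_singleton]
    rintro p rfl
    exact ⟨hfw, div_ne_zero hfx hfw, fun he => hwx ((div_eq_one_iff_eq hfw).1 he).symm⟩)
  have hvP := h.prodInj_of_lineInj hv
  obtain ⟨h₁, -, h₃⟩ := h.map_add_ne_of_not_dep hw (hvs (f w, f x / f w) (by simp))
  have e₁ := hx.map_add w hw hwx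
  have e₂ := hx.map_add _ (h.prodInj_add hw hvP h₁) h₃
  have e : w + x + v = w + v + x := by ring
  refine h.prodInj_of_ne ((map_ne_zero f).1 (by rwa [e₁])) hvP (by rwa [e₁]) ?_ ?_
  · rw [e, e₂, e₁]
    exact h.map_add_ne_left hw hvP h₁
  · rw [e, e₂]
    exact h.map_add_ne_right hw hvP h₁

theorem one_add_isSmall (h : IsDependenceHom k f D) (hx : IsSmall k f x) :
    ProdInj k f (1 + x) ∧ f (1 + x) = 1 := by
  by_cases h1 : f x = 1
  -- When f x = 1, the definition of infinitesimal says nothing about 1 + x, so 1 is replaced by a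
  -- difference (a + 1) - a of elements with distinct nontrivial values.
  · have hstep : ∀ w, LineInj k f w → ProdInj k f (w + x) ∧ f (w + x) = f w := fun w hw =>
      ⟨h.prodInj_add_isSmall_of_ne hx (h.prodInj_of_lineInj hw) (h1 ▸ hw.ne_one),
        hx.map_add w (h.prodInj_of_lineInj hw) (h1 ▸ hw.ne_one)⟩
    have hP : ProdInj k f (1 + x) := by
      obtain ⟨a, -, ha, -, -⟩ := h.exists_pair
      obtain ⟨hp, he⟩ := hstep _ (ha.add_const k.one_mem)
      have := h.prodInj_sub hp (h.prodInj_of_lineInj ha) (by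
        rw [he]
        exact ha.map_add_ne k.one_mem one_ne_zero)
      rwa [show a + 1 + x - a = 1 + x by ring] at this
    refine ⟨hP, ?_⟩
    by_contra hne
    have hL := h.lineInj_of_prodInj hP hne
    -- For w independent of 1 + x, the value of w + (1 + x) is independent of f w. But it equals f
    -- (w + 1), which depends on f w.
    obtain ⟨w, hw, hwx⟩ := h.exists_not_dep_one hL.map_ne_zero hne
    have h2 := h.not_dep_add hw hL hwx
    rw [show w + (1 + x) = w + 1 + x by ring, (hstep _ (hw.add_const k.one_mem)).2] at h2
    exact h2 (h.dep_add w 1 k.one_mem)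
  · have hne : f 1 ≠ f x := by
      rw [map_one]
      exact fun he => h1 he.symm
    exact ⟨h.prodInj_add_isSmall_of_ne hx h.prodInj_one hne,
      (hx.map_add 1 h.prodInj_one hne).trans (map_one f)⟩

theorem prodInj_add_isSmall (h : IsDependenceHom k f D) (hw : ProdInj k f w)
    (hx : IsSmall k f x) : ProdInj k f (w + x) ∧ f (w + x) = f w := by
  obtain ⟨h1, h2⟩ := h.one_add_isSmall (h.isSmall_mul hx (h.prodInj_inv hw))
  have e : w + x = w * (1 + x * w⁻¹) := by
    field_simp [hw.ne_zero]
  rw [e, map_mul, h2, mul_one]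
  exact ⟨h.prodInj_mul hw h1, rfl⟩

theorem isSmall_neg (h : IsDependenceHom k f D) (hx : IsSmall k f x) : IsSmall k f (-x) := by
  rw [← mul_neg_one]
  exact h.isSmall_mul hx (h.prodInj_neg h.prodInj_one)

theorem isSmall_add (h : IsDependenceHom k f D) (hx : IsSmall k f x) (hy : IsSmall k f y)
    (hxy : x + y ≠ 0) : IsSmall k f (x + y) := by
  refine ⟨hxy, fun hp => hy.not_prodInj ?_, fun w hw _ => ?_⟩
  · have := (h.prodInj_add_isSmall hp (h.isSmall_neg hx)).1
    rwa [show x + y + -x = y by ring] at this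
  · rw [← add_assoc, (h.prodInj_add_isSmall (h.prodInj_add_isSmall hw hx).1 hy).2,
      (h.prodInj_add_isSmall hw hx).2]

theorem isSmall_mul_isSmall (h : IsDependenceHom k f D) (hx : IsSmall k f x)
    (hy : IsSmall k f y) : IsSmall k f (x * y) := by
  have h1 := h.isSmall_mul hy (h.one_add_isSmall hx).1
  have e : y * (1 + x) + -y = x * y := by ring
  have := h.isSmall_add h1 (h.isSmall_neg hy) (by
    rw [e]
    exact mul_ne_zero hx.ne_zero hy.ne_zero)
  rwa [e] at this

/-- Otherwise (x + y)⁻¹ is infinitesimal, and then so is 1 = (x + y)⁻¹ x + (x + y)⁻¹ y. -/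
theorem isSmall_add_prodInj (h : IsDependenceHom k f D) (hx : ProdInj k f x)
    (hy : ProdInj k f y) (hxy : x + y ≠ 0) (hp : ¬ ProdInj k f (x + y)) :
    IsSmall k f (x + y) := by
  refine (h.isSmall_or_isSmall_inv hxy hp).resolve_right fun hi => ?_
  have e : (x + y)⁻¹ * x + (x + y)⁻¹ * y = 1 := by
    rw [← mul_add, inv_mul_cancel₀ hxy]
  have := h.isSmall_add (h.isSmall_mul hi hx) (h.isSmall_mul hi hy) (by
    rw [e]
    exact one_ne_zero)
  rw [e] at this
  exact this.not_prodInj h.prodInj_one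

/-- The valuation ring whose units are the products of two elements on injective lines. -/
def valuationSubring (h : IsDependenceHom k f D) : ValuationSubring K where
  carrier := {x | x = 0 ∨ ProdInj k f x ∨ IsSmall k f x}
  zero_mem' := Or.inl rfl
  one_mem' := Or.inr (Or.inl h.prodInj_one)
  neg_mem' := by
    rintro x (rfl | hx | hx)
    · exact Or.inl neg_zero
    · exact Or.inr (Or.inl (h.prodInj_neg hx))
    · exact Or.inr (Or.inr (h.isSmall_neg hx))
  mul_mem' := by
    rintro x y (rfl | hx | hx) (rfl | hy | hy)
    · exact Or.inl (zero_mul _)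
    · exact Or.inl (zero_mul _)
    · exact Or.inl (zero_mul _)
    · exact Or.inl (mul_zero _)
    · exact Or.inr (Or.inl (h.prodInj_mul hx hy))
    · exact Or.inr (Or.inr (mul_comm y x ▸ h.isSmall_mul hy hx))
    · exact Or.inl (mul_zero _)
    · exact Or.inr (Or.inr (h.isSmall_mul hx hy))
    · exact Or.inr (Or.inr (h.isSmall_mul_isSmall hx hy))
  add_mem' := by
    intro x y hx hy
    by_cases h0 : x + y = 0
    · exact Or.inl h0
    rcases hx with rfl | hx | hx
    · rwa [zero_add]
    · rcases hy with rfl | hy | hy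
      · rw [add_zero]
        exact Or.inr (Or.inl hx)
      · by_cases hp : ProdInj k f (x + y)
        · exact Or.inr (Or.inl hp)
        · exact Or.inr (Or.inr (h.isSmall_add_prodInj hx hy h0 hp))
      · exact Or.inr (Or.inl (h.prodInj_add_isSmall hx hy).1)
    · rcases hy with rfl | hy | hy
      · rw [add_zero]
        exact Or.inr (Or.inr hx)
      · rw [add_comm]
        exact Or.inr (Or.inl (h.prodInj_add_isSmall hy hx).1)
      · exact Or.inr (Or.inr (h.isSmall_add hx hy h0))
  mem_or_inv_mem' := by
    intro x
    by_cases h0 : x = 0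
    · exact Or.inl (Or.inl h0)
    by_cases hp : ProdInj k f x
    · exact Or.inl (Or.inr (Or.inl hp))
    · exact (h.isSmall_or_isSmall_inv h0 hp).imp (fun hs => Or.inr (Or.inr hs))
        fun hs => Or.inr (Or.inr hs)

theorem mem_valuationSubring (h : IsDependenceHom k f D) :
    x ∈ h.valuationSubring ↔ x = 0 ∨ ProdInj k f x ∨ IsSmall k f x := Iff.rfl

theorem prodInj_of_valuation_eq_one (h : IsDependenceHom k f D)
    (hx : h.valuationSubring.valuation x = 1) : ProdInj k f x := by
  have hmem := (h.valuationSubring.valuation_le_one_iff x).1 hx.le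
  have hinv := (h.valuationSubring.valuation_le_one_iff x⁻¹).1 (by rw [map_inv₀, hx, inv_one])
  rcases h.mem_valuationSubring.1 hmem with rfl | hp | hs
  · simp at hx
  · exact hp
  · rcases h.mem_valuationSubring.1 hinv with h0 | hp | hs'
    · exact absurd h0 (inv_ne_zero hs.ne_zero)
    · simpa using h.prodInj_inv hp
    · exact absurd hs' (h.not_isSmall_inv hs)

theorem map_one_add_of_valuation_lt_one (h : IsDependenceHom k f D)
    (hx : h.valuationSubring.valuation x < 1) : f (1 + x) = 1 := by
  have hmem := (h.valuationSubring.valuation_le_one_iff x).1 hx.le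
  rcases h.mem_valuationSubring.1 hmem with rfl | hp | hs
  · simp
  · have hinv : x⁻¹ ∈ h.valuationSubring :=
      h.mem_valuationSubring.2 (Or.inr (Or.inl (h.prodInj_inv hp)))
    have hle := (h.valuationSubring.valuation_le_one_iff x⁻¹).2 hinv
    rw [map_inv₀] at hle
    exact absurd hle (not_le.2 ((one_lt_inv₀ (by
      rw [zero_lt_iff, Ne, map_eq_zero]
      exact hp.ne_zero)).2 hx))
  · exact (h.one_add_isSmall hs).2

end IsDependenceHom

end Dependence

/-! ### Transcendence degree at most 1 and algebraicity over a simple extension -/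

section AlgebraicDependence

open IntermediateField

variable {F : Type v} [Field F] {K : Type u} [Field K] [Algebra F K] {x y : K}

open scoped IntermediateField.algebraAdjoinAdjoin in
theorem trdeg_adjoin_simple_le_one (x : K) : Algebra.trdeg F F⟮x⟯ ≤ 1 := by
  have : FaithfulSMul F (Algebra.adjoin F {x}) :=
    (faithfulSMul_iff_algebraMap_injective _ _).2 (algebraMap F _).injective
  have h1 := trdeg_add_eq F (Algebra.adjoin F {x}) (A := F⟮x⟯)
  rw [trdeg_eq_zero (R := Algebra.adjoin F {x}), add_zero] at h1
  rw [← h1]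
  have h2 := lift_trdeg_le_of_surjective (Polynomial.aeval (R := F)
      (⟨x, Algebra.self_mem_adjoin_singleton F x⟩ : Algebra.adjoin F {x})) (by
    rintro ⟨z, hz⟩
    have hz' := hz
    rw [Algebra.adjoin_singleton_eq_range_aeval] at hz'
    obtain ⟨p, rfl⟩ := hz'
    exact ⟨p, Subtype.ext (by simp)⟩)
  simpa using h2

/-- F(x, y) embeds into the algebraic closure of F(x) in K, which has the same transcendence degree
over F as F(x). -/
theorem trdeg_adjoin_pair_le_one (hy : IsAlgebraic F⟮x⟯ y) :
    Algebra.trdeg F (adjoin F {x, y}) ≤ 1 := by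
  let C := algebraicClosure F⟮x⟯ K
  have : FaithfulSMul F F⟮x⟯ :=
    (faithfulSMul_iff_algebraMap_injective _ _).2 (algebraMap F _).injective
  have : FaithfulSMul F⟮x⟯ C :=
    (faithfulSMul_iff_algebraMap_injective _ _).2 (algebraMap F⟮x⟯ C).injective
  have h1 := trdeg_add_eq F F⟮x⟯ (A := C)
  rw [trdeg_eq_zero (R := F⟮x⟯), add_zero] at h1
  have hle : adjoin F {x, y} ≤ C.restrictScalars F := by
    rw [adjoin_le_iff]
    rintro z (rfl | rfl)
    · exact mem_algebraicClosure_iff.2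
        (isAlgebraic_algebraMap (AdjoinSimple.gen F z : F⟮z⟯))
    · exact mem_algebraicClosure_iff.2 hy
  have h2 := trdeg_le_of_injective (IntermediateField.inclusion hle)
    (IntermediateField.inclusion_injective hle)
  exact (h2.trans h1.symm.le).trans (trdeg_adjoin_simple_le_one x)

theorem isAlgebraic_of_trdeg_adjoin_pair_le_one (hx : Transcendental F x)
    (h : Algebra.trdeg F (adjoin F {x, y}) ≤ 1) : IsAlgebraic F⟮x⟯ y := by
  by_contra hy
  let E := adjoin F {x, y}
  let x' : E := ⟨x, subset_adjoin F _ (by simp)⟩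
  let y' : E := ⟨y, subset_adjoin F _ (by simp)⟩
  have hind : AlgebraicIndependent F (fun _ : Unit => x) :=
    algebraicIndependent_unique_type_iff.2 hx
  have hopt := (hind.option_iff_transcendental y).2 (by
    rw [Set.range_const]
    exact fun ha => hy (isAlgebraic_adjoin_iff.2 ha))
  have hE : AlgebraicIndependent F (fun o : Option Unit => o.elim y' fun _ => x') := by
    refine AlgebraicIndependent.of_comp E.val ?_
    convert hopt using 1
    ext o
    cases o <;> rfl
  have := hE.lift_cardinalMk_le_trdeg.trans (Cardinal.lift_le.2 h)
  simp at this

theorem isAlgebraic_adjoin_simple_self (x : K) : IsAlgebraic F⟮x⟯ x :=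
  isAlgebraic_algebraMap (AdjoinSimple.gen F x : F⟮x⟯)

theorem isAlgebraic_adjoin_simple_trans {z : K} (hy : IsAlgebraic F⟮x⟯ y)
    (hz : IsAlgebraic F⟮y⟯ z) : IsAlgebraic F⟮x⟯ z := by
  rw [isAlgebraic_adjoin_iff] at *
  refine hz.adjoin_of_forall_isAlgebraic fun w hw => ?_
  rwa [show w = y from hw.1]

end AlgebraicDependence

/-! ### Algebraic dependence as a dependence relation on the quotient group -/

section Quotient

open IntermediateField

variable {L : Type v} [Field L] {F : Subfield L}

theorem mk_unitsOf_eq_one {x : Lˣ} : (x : Lˣ ⧸ unitsOf F) = 1 ↔ (x : L) ∈ F := by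
  rw [QuotientGroup.eq_one_iff, mem_unitsOf]

theorem adjoin_pair_le_of_mk_eq {x y x' y' : Lˣ}
    (hx : (x : Lˣ ⧸ unitsOf F) = x') (hy : (y : Lˣ ⧸ unitsOf F) = y') :
    adjoin F {(x : L), (y : L)} ≤ adjoin F {(x' : L), (y' : L)} := by
  have key : ∀ {z z' : Lˣ} (E : IntermediateField F L), (z : Lˣ ⧸ unitsOf F) = z' →
      (z' : L) ∈ E → (z : L) ∈ E := by
    intro z z' E h hz'
    have hc := mem_unitsOf.1 (QuotientGroup.eq.1 h.symm)
    have e : (z : L) = z' * ((z'⁻¹ * z : Lˣ) : L) := by simp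
    rw [e]
    exact E.mul_mem hz' (E.algebraMap_mem ⟨_, hc⟩)
  rw [adjoin_le_iff]
  rintro z (rfl | rfl)
  · exact key _ hx (subset_adjoin F _ (by simp))
  · exact key _ hy (subset_adjoin F _ (by simp))

theorem algDep_mk {x y : Lˣ} : AlgDep F (x : Lˣ ⧸ unitsOf F) (y : Lˣ ⧸ unitsOf F) ↔
    Algebra.trdeg F (adjoin F {(x : L), (y : L)}) ≤ 1 := by
  refine ⟨fun ⟨x', y', hx, hy, h⟩ => ?_, fun h => ⟨x, y, rfl, rfl, h⟩⟩
  rwa [le_antisymm (adjoin_pair_le_of_mk_eq hx.symm hy.symm) (adjoin_pair_le_of_mk_eq hx hy)]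

theorem AlgDep.symm {H : Subgroup Lˣ} {a b : Lˣ ⧸ H} (h : AlgDep F a b) : AlgDep F b a := by
  obtain ⟨x, y, hx, hy, h⟩ := h
  refine ⟨y, x, hy, hx, ?_⟩
  rwa [Set.pair_comm]

/-- As F is algebraically closed in L, a nontrivial class has transcendental lifts. This form
reduces transitivity and the subgroup property to closure properties of algebraic elements. -/
theorem algDep_iff_isAlgebraic (hF : ∀ y : L, IsAlgebraic F y → y ∈ F) {x y : Lˣ} :
    AlgDep F (x : Lˣ ⧸ unitsOf F) (y : Lˣ ⧸ unitsOf F) ↔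
      (x : Lˣ ⧸ unitsOf F) = 1 ∨ IsAlgebraic F⟮(x : L)⟯ (y : L) := by
  rw [mk_unitsOf_eq_one]
  refine ⟨fun h => or_iff_not_imp_left.2 fun hx => ?_, ?_⟩
  · exact isAlgebraic_of_trdeg_adjoin_pair_le_one (fun ha => hx (hF _ ha)) (algDep_mk.1 h)
  · rintro (h | h)
    · refine AlgDep.symm (algDep_mk.2 (trdeg_adjoin_pair_le_one ?_))
      exact isAlgebraic_algebraMap (algebraMap F F⟮(y : L)⟯ ⟨x, h⟩)
    · exact algDep_mk.2 (trdeg_adjoin_pair_le_one h)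

theorem algDep_refl (a : Lˣ ⧸ unitsOf F) : AlgDep F a a := by
  obtain ⟨x, rfl⟩ := QuotientGroup.mk_surjective a
  exact algDep_mk.2 (trdeg_adjoin_pair_le_one (isAlgebraic_adjoin_simple_self _))

theorem algDep_one_left (b : Lˣ ⧸ unitsOf F) : AlgDep F 1 b := by
  obtain ⟨y, rfl⟩ := QuotientGroup.mk_surjective b
  refine AlgDep.symm (algDep_mk (y := 1).2 (trdeg_adjoin_pair_le_one ?_))
  exact isAlgebraic_one

theorem algDep_trans (hF : ∀ y : L, IsAlgebraic F y → y ∈ F) {a b c : Lˣ ⧸ unitsOf F}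
    (hb : b ≠ 1) (hab : AlgDep F a b) (hbc : AlgDep F b c) : AlgDep F a c := by
  obtain ⟨x, rfl⟩ := QuotientGroup.mk_surjective a
  obtain ⟨y, rfl⟩ := QuotientGroup.mk_surjective b
  obtain ⟨z, rfl⟩ := QuotientGroup.mk_surjective c
  rw [algDep_iff_isAlgebraic hF] at *
  exact hab.imp_right fun h => isAlgebraic_adjoin_simple_trans h (hbc.resolve_left hb)

theorem algDep_mul_right (hF : ∀ y : L, IsAlgebraic F y → y ∈ F) {a b c : Lˣ ⧸ unitsOf F}
    (hab : AlgDep F a b) (hac : AlgDep F a c) : AlgDep F a (b * c) := by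
  obtain ⟨x, rfl⟩ := QuotientGroup.mk_surjective a
  obtain ⟨y, rfl⟩ := QuotientGroup.mk_surjective b
  obtain ⟨z, rfl⟩ := QuotientGroup.mk_surjective c
  rw [← QuotientGroup.mk_mul]
  rw [algDep_iff_isAlgebraic hF] at *
  rcases hab with h | h
  · exact Or.inl h
  · exact hac.imp_right fun h' => by
      rw [Units.val_mul]
      exact h.mul h'

theorem algDep_inv_right (hF : ∀ y : L, IsAlgebraic F y → y ∈ F) {a b : Lˣ ⧸ unitsOf F}
    (hab : AlgDep F a b) : AlgDep F a b⁻¹ := by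
  obtain ⟨x, rfl⟩ := QuotientGroup.mk_surjective a
  obtain ⟨y, rfl⟩ := QuotientGroup.mk_surjective b
  rw [← QuotientGroup.mk_inv]
  rw [algDep_iff_isAlgebraic hF] at *
  exact hab.imp_right fun h => by
    rw [Units.val_inv_eq_inv_val]
    exact h.inv

theorem pow_ne_one_of_algebraicallyClosedIn (hF : ∀ y : L, IsAlgebraic F y → y ∈ F)
    {a : Lˣ ⧸ unitsOf F} (ha : a ≠ 1) {n : ℕ} (hn : n ≠ 0) : a ^ n ≠ 1 := by
  obtain ⟨x, rfl⟩ := QuotientGroup.mk_surjective a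
  rw [← QuotientGroup.mk_pow]
  rw [Ne, mk_unitsOf_eq_one] at *
  intro h
  rw [Units.val_pow_eq_pow_val] at h
  exact ha (hF _ (IsAlgebraic.of_pow (Nat.pos_of_ne_zero hn)
    (isAlgebraic_algebraMap (⟨_, h⟩ : F))))

/-- Algebraic dependence, extended by zero. -/
def AlgDepZero (F : Subfield L) (a b : WithZero (Lˣ ⧸ unitsOf F)) : Prop :=
  ∀ a' b' : Lˣ ⧸ unitsOf F, a = a' → b = b' → AlgDep F a' b'

theorem algDepZero_coe {a b : Lˣ ⧸ unitsOf F} :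
    AlgDepZero F (a : WithZero (Lˣ ⧸ unitsOf F)) b ↔ AlgDep F a b := by
  refine ⟨fun h => h a b rfl rfl, fun h a' b' ha hb => ?_⟩
  rwa [← WithZero.coe_inj.1 ha, ← WithZero.coe_inj.1 hb]

theorem isDependence_algDepZero (hF : ∀ y : L, IsAlgebraic F y → y ∈ F) :
    IsDependence (AlgDepZero F) where
  zero_left b a' b' ha _ := absurd ha.symm WithZero.coe_ne_zero
  one_left b a' b' ha _ := by
    rw [← WithZero.coe_one, WithZero.coe_inj] at ha
    exact ha ▸ algDep_one_left b'
  refl a a' b' ha hb := by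
    rw [ha, WithZero.coe_inj] at hb
    exact hb ▸ algDep_refl a'
  symm h a' b' ha hb := (h b' a' hb ha).symm
  trans {a b c} hb₀ hb hab hbc a' c' ha hc := by
    obtain ⟨b', rfl⟩ := WithZero.ne_zero_iff_exists.1 hb₀
    refine algDep_trans hF ?_ (hab a' b' ha rfl) (hbc b' c' rfl hc)
    rintro rfl
    exact hb rfl
  mul_right {a b c} hab hac a' d' ha hd := by
    have h0 : b * c ≠ 0 := hd ▸ WithZero.coe_ne_zero
    obtain ⟨b', rfl⟩ := WithZero.ne_zero_iff_exists.1 (left_ne_zero_of_mul h0)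
    obtain ⟨c', rfl⟩ := WithZero.ne_zero_iff_exists.1 (right_ne_zero_of_mul h0)
    rw [← WithZero.coe_mul, WithZero.coe_inj] at hd
    exact hd ▸ algDep_mul_right hF (hab a' b' ha rfl) (hac a' c' ha rfl)
  inv_right {a b} hab a' d' ha hd := by
    have h0 : b ≠ 0 := inv_eq_zero.not.1 (hd ▸ WithZero.coe_ne_zero)
    obtain ⟨b', rfl⟩ := WithZero.ne_zero_iff_exists.1 h0
    rw [← WithZero.coe_inv, WithZero.coe_inj] at hd
    exact hd ▸ algDep_inv_right hF (hab a' b' ha rfl)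
  pow_ne_one {a n} ha₀ ha hn := by
    obtain ⟨a', rfl⟩ := WithZero.ne_zero_iff_exists.1 ha₀
    rw [← WithZero.coe_pow, ← WithZero.coe_one, Ne, WithZero.coe_inj] at *
    exact pow_ne_one_of_algebraicallyClosedIn hF ha hn

end Quotient

/-! ### Injective lines in projective space and in coordinates -/

section Lines

open scoped Classical in
/-- A homomorphism on `ℙ(K)`, extended by zero to a multiplicative map on `K`. -/
noncomputable def extendZero {K : Type u} [Field K] {A : Type v} [CommGroup A] (ψ : PK K →* A) :
    K →*₀ WithZero A where
  toFun x := if hx : x = 0 then 0 else (ψ (Units.mk0 x hx : Kˣ) : WithZero A)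
  map_zero' := by simp
  map_one' := by
    have h : (Units.mk0 (1 : K) one_ne_zero) = 1 := by ext; rfl
    simp [h]
  map_mul' x y := by
    by_cases hx : x = 0
    · simp [hx]
    by_cases hy : y = 0
    · simp [hy]
    simp only [hx, hy, mul_eq_zero, or_self, dite_false]
    rw [← WithZero.coe_mul, ← map_mul, ← QuotientGroup.mk_mul]
    congr 3
    ext
    simp

variable {K : Type u} [Field K] {A : Type v} [CommGroup A] {ψ : PK K →* A}

theorem extendZero_mk0 {x : K} (hx : x ≠ 0) :
    extendZero ψ x = (ψ (Units.mk0 x hx : Kˣ) : WithZero A) := by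
  simp [extendZero, hx]

theorem extendZero_unit (x : Kˣ) : extendZero ψ (x : K) = (ψ (x : PK K) : WithZero A) := by
  rw [extendZero_mk0 x.ne_zero, Units.mk0_val]

theorem extendZero_eq_one_of_mem {c : K} (hc : c ∈ PrimeField K) (hc₀ : c ≠ 0) :
    extendZero ψ c = 1 := by
  have h : ((Units.mk0 c hc₀ : Kˣ) : PK K) = 1 := mk_unitsOf_eq_one.2 hc
  rw [extendZero_mk0 hc₀, h, map_one, WithZero.coe_one]

theorem extendZero_eq_iff_restrict_eq {V : Submodule (PrimeField K) K} {v w : V} (hv : v ≠ 0)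
    (hw : w ≠ 0) : extendZero ψ (v : K) = extendZero ψ (w : K) ↔
      restrict ψ V (Projectivization.mk _ v hv) = restrict ψ V (Projectivization.mk _ w hw) := by
  have hv' : (v : K) ≠ 0 := fun h => hv (Subtype.ext h)
  have hw' : (w : K) ≠ 0 := fun h => hw (Subtype.ext h)
  rw [extendZero_mk0 hv', extendZero_mk0 hw', WithZero.coe_inj]
  rfl

/-- The condition on ψ P excludes the point 1, which lies on injective lines but does not span one
together with 1. -/
theorem exists_lineInj_of_mem_smallU {P : PK K} (hP : P ∈ smallU ψ) (hP₁ : ψ P ≠ 1) :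
    ∃ x : Kˣ, (x : PK K) = P ∧ LineInj (PrimeField K) (extendZero ψ) x := by
  obtain ⟨V, -, ⟨u, huV, hu⟩, hinj, x, hxV, rfl⟩ := hP
  have huk : (u : K) ∈ PrimeField K := mk_unitsOf_eq_one.1 hu
  have h1V : (1 : K) ∈ V := by
    have := V.smul_mem (⟨(u : K), huk⟩⁻¹ : PrimeField K) huV
    rw [Subfield.smul_def] at this
    simpa using this
  have hxk : (x : K) ∉ PrimeField K := fun h => hP₁ (by
    rw [mk_unitsOf_eq_one.2 h, map_one])
  have hadd : ∀ c ∈ PrimeField K, (x : K) + c ∈ V := fun c hc => by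
    have := V.add_mem hxV (V.smul_mem (⟨c, hc⟩ : PrimeField K) h1V)
    rw [Subfield.smul_def] at this
    simpa using this
  have hne : ∀ c ∈ PrimeField K, (x : K) + c ∉ PrimeField K := fun c hc h => hxk (by
    simpa using (PrimeField K).sub_mem h hc)
  have key : ∀ v w : V, v ≠ 0 → w ≠ 0 → extendZero ψ (v : K) = extendZero ψ (w : K) →
      ∃ a ∈ PrimeField K, a * (w : K) = v := by
    intro v w hv hw he
    have := hinj ((extendZero_eq_iff_restrict_eq hv hw).1 he)
    obtain ⟨a, ha⟩ := (Projectivization.mk_eq_mk_iff' _ _ _ hv hw).1 this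
    exact ⟨a, a.2, congrArg Subtype.val ha⟩
  have hV0 : ∀ c (hc : c ∈ PrimeField K), (⟨_, hadd c hc⟩ : V) ≠ 0 := fun c hc h =>
    hne c hc (by
      rw [show (x : K) + c = 0 from congrArg Subtype.val h]
      exact (PrimeField K).zero_mem)
  refine ⟨x, rfl, fun c hc he => ?_, fun c hc d hd he => ?_⟩
  · obtain ⟨a, ha, hax⟩ := key ⟨_, hadd c hc⟩ ⟨1, h1V⟩ (hV0 c hc)
      (fun h => one_ne_zero (congrArg Subtype.val h)) (by simpa using he)
    refine hne c hc ?_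
    rw [show (x : K) + c = a * 1 from hax.symm, mul_one]
    exact ha
  · obtain ⟨a, ha, hax⟩ := key ⟨_, hadd c hc⟩ ⟨_, hadd d hd⟩ (hV0 c hc) (hV0 d hd) he
    have hax' : a * ((x : K) + d) = x + c := hax
    by_cases ha1 : a = 1
    · rw [ha1, one_mul] at hax'
      exact (add_left_cancel hax').symm
    · exfalso
      have ha1' : 1 - a ≠ 0 := sub_ne_zero.2 (Ne.symm ha1)
      have : (x : K) = (a * d - c) / (1 - a) := by
        rw [eq_div_iff ha1']
        linear_combination -hax'
      refine hxk ?_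
      rw [this]
      exact (PrimeField K).div_mem ((PrimeField K).sub_mem ((PrimeField K).mul_mem ha hd) hc)
        ((PrimeField K).sub_mem (PrimeField K).one_mem ha)

theorem mem_smallU_of_lineInj {x : Kˣ} (hx : LineInj (PrimeField K) (extendZero ψ) x) :
    (x : PK K) ∈ smallU ψ := by
  have hxk := hx.notMem
  let V : Submodule (PrimeField K) K := Submodule.span _ {1, (x : K)}
  have hmem : ∀ v : K, v ∈ V ↔ ∃ a ∈ PrimeField K, ∃ b ∈ PrimeField K, a + b * x = v := by
    intro v
    rw [Submodule.mem_span_pair]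
    constructor
    · rintro ⟨a, b, rfl⟩
      exact ⟨a, a.2, b, b.2, by simp [Subfield.smul_def]⟩
    · rintro ⟨a, ha, b, hb, rfl⟩
      exact ⟨⟨a, ha⟩, ⟨b, hb⟩, by simp [Subfield.smul_def]⟩
  have hli : LinearIndependent (PrimeField K) ![(1 : K), (x : K)] := by
    rw [LinearIndependent.pair_iff]
    intro s t hst
    have hst' : (s : K) + t * x = 0 := by simpa [Subfield.smul_def] using hst
    have ht : t = 0 := by
      by_contra ht
      have ht' : (t : K) ≠ 0 := fun h => ht (Subtype.ext h)
      refine hxk ?_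
      rw [show (x : K) = -s / t by rw [eq_div_iff ht']; linear_combination hst']
      exact (PrimeField K).div_mem ((PrimeField K).neg_mem s.2) t.2
    refine ⟨Subtype.ext ?_, ht⟩
    simpa [ht] using hst'
  refine ⟨V, ?_, ⟨1, (hmem _).2 ⟨1, one_mem _, 0, zero_mem _, by simp⟩, rfl⟩, ?_,
    ⟨x, (hmem _).2 ⟨0, zero_mem _, 1, one_mem _, by simp⟩, rfl⟩⟩
  · have := finrank_span_eq_card hli
    rw [Matrix.range_cons_cons_empty, Fintype.card_fin] at this
    exact this
  -- Up to scalars from k, the points of the line are 1 and the x + c, which are the points that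
  -- `LineInj` speaks of.
  · have hform : ∀ v ∈ V, v ≠ 0 → v ∈ PrimeField K ∨
        ∃ b ∈ PrimeField K, b ≠ 0 ∧ ∃ c ∈ PrimeField K, v = b * (x + c) := by
      intro v hv hv0
      obtain ⟨a, ha, b, hb, rfl⟩ := (hmem v).1 hv
      by_cases hb0 : b = 0
      · left
        simpa [hb0] using ha
      · right
        refine ⟨b, hb, hb0, a / b, (PrimeField K).div_mem ha hb, ?_⟩
        field_simp
        ring
    have hval : ∀ b ∈ PrimeField K, b ≠ 0 → ∀ y : K, extendZero ψ (b * y) = extendZero ψ y := by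
      intro b hb hb0 y
      rw [map_mul, extendZero_eq_one_of_mem hb hb0, one_mul]
    intro P Q hPQ
    induction P using Projectivization.ind with | h v hv => ?_
    induction Q using Projectivization.ind with | h w hw => ?_
    have hv' : (v : K) ≠ 0 := fun h => hv (Subtype.ext h)
    have hw' : (w : K) ≠ 0 := fun h => hw (Subtype.ext h)
    have he := (extendZero_eq_iff_restrict_eq hv hw).2 hPQ
    rw [Projectivization.mk_eq_mk_iff']
    suffices h : ∃ a ∈ PrimeField K, a * (w : K) = v by
      obtain ⟨a, ha, haw⟩ := h
      exact ⟨⟨a, ha⟩, Subtype.ext haw⟩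
    rcases hform v v.2 hv' with hvk | ⟨b, hb, hb0, c, hc, hvb⟩ <;>
      rcases hform w w.2 hw' with hwk | ⟨b', hb', hb0', c', hc', hwb⟩
    · exact ⟨v / w, (PrimeField K).div_mem hvk hwk, div_mul_cancel₀ _ hw'⟩
    · rw [hwb, hval b' hb' hb0', extendZero_eq_one_of_mem hvk hv'] at he
      exact absurd he.symm (hx.1 c' hc')
    · rw [hvb, hval b hb hb0, extendZero_eq_one_of_mem hwk hw'] at he
      exact absurd he (hx.1 c hc)
    · rw [hvb, hwb, hval b hb hb0, hval b' hb' hb0'] at he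
      have hcc := hx.2 c hc c' hc' he
      refine ⟨b / b', (PrimeField K).div_mem hb hb', ?_⟩
      rw [hvb, hwb, hcc]
      field_simp

end Lines

/-! ### Application to the given homomorphism -/

section Main

open IntermediateField

variable {K : Type u} [Field K] {L : Type v} [Field L] {kt : Subfield K} {lt : Subfield L}

theorem isDependenceHom_extendZero (hlt : ∀ y : L, IsAlgebraic lt y → y ∈ lt)
    {ψ : PK K →* Lˣ ⧸ unitsOf lt} (hψ : PreservesAlgDep kt lt ψ)
    (hgen : ∃ y₁ ∈ ψ '' smallU ψ, ∃ y₂ ∈ ψ '' smallU ψ, ¬ AlgDep lt y₁ y₂) :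
    IsDependenceHom (PrimeField K) (extendZero ψ) (AlgDepZero lt) where
  toIsDependence := isDependence_algDepZero hlt
  map_eq_one c hc hc₀ := extendZero_eq_one_of_mem hc hc₀
  dep_add x c hc := by
    have hD := isDependence_algDepZero hlt
    by_cases hx : x = 0
    · rw [hx, map_zero]
      exact hD.zero_left _
    by_cases hxc : x + c = 0
    · rw [hxc, map_zero]
      exact hD.zero_right
    rw [extendZero_mk0 hx, extendZero_mk0 hxc, algDepZero_coe]
    -- The prime field lies in `kt`, so x + c belongs to the field generated by x over `kt`.
    refine hψ _ _ ⟨_, _, rfl, rfl, trdeg_adjoin_pair_le_one ?_⟩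
    have hckt : c ∈ kt := (bot_le : PrimeField K ≤ kt) hc
    exact (isAlgebraic_adjoin_simple_self x).add
      (isAlgebraic_algebraMap (algebraMap kt kt⟮x⟯ ⟨c, hckt⟩))
  exists_pair := by
    obtain ⟨-, ⟨P, hP, rfl⟩, -, ⟨Q, hQ, rfl⟩, hPQ⟩ := hgen
    have hP₁ : ψ P ≠ 1 := fun h => hPQ (by
      rw [h]
      exact algDep_one_left _)
    have hQ₁ : ψ Q ≠ 1 := fun h => hPQ (by
      rw [h]
      exact (algDep_one_left _).symm)
    obtain ⟨x, rfl, hx⟩ := exists_lineInj_of_mem_smallU (A := Lˣ ⧸ unitsOf lt) (ψ := ψ)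
      (P := P) hP hP₁
    obtain ⟨y, rfl, hy⟩ := exists_lineInj_of_mem_smallU (A := Lˣ ⧸ unitsOf lt) (ψ := ψ)
      (P := Q) hQ hQ₁
    refine ⟨x, y, hx, hy, ?_⟩
    rwa [extendZero_unit, extendZero_unit, algDepZero_coe]

theorem mem_bigU_of_prodInj {A : Type w} [CommGroup A] {ψ : PK K →* A} {x : Kˣ}
    (hx : ProdInj (PrimeField K) (extendZero ψ) (x : K)) : (x : PK K) ∈ bigU ψ := by
  obtain ⟨y, z, hy, hz, he⟩ := hx
  have hx' : x = Units.mk0 y hy.ne_zero * Units.mk0 z hz.ne_zero := Units.ext he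
  refine ⟨_, mem_smallU_of_lineInj (x := Units.mk0 y hy.ne_zero) hy, _,
    mem_smallU_of_lineInj (x := Units.mk0 z hz.ne_zero) hz, ?_⟩
  rw [hx', QuotientGroup.mk_mul]

end Main

end AlgDepHom

theorem mainTheorem7 {K : Type u} [Field K] {L : Type v} [Field L]
    (kt : Subfield K) (lt : Subfield L)
    (hlt : ∀ y : L, IsAlgebraic lt y → y ∈ lt)
    (ψ : AlgDepHom.PK K →* Lˣ ⧸ AlgDepHom.unitsOf lt)
    (hψ : AlgDepHom.PreservesAlgDep kt lt ψ)
    (hgen : ∃ y₁ ∈ ψ '' AlgDepHom.smallU ψ, ∃ y₂ ∈ ψ '' AlgDepHom.smallU ψ,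
      ¬ AlgDepHom.AlgDep lt y₁ y₂)
    (hF : ∃ V : Submodule (AlgDepHom.PrimeField K) K, AlgDepHom.IsTypeF ψ V) :
    ∃ (Γ : Type u) (_ : LinearOrderedCommGroupWithZero Γ) (ν : Valuation K Γ),
      Function.Surjective ν ∧
      (∀ x : Kˣ, ν x = 1 → (x : AlgDepHom.PK K) ∈ AlgDepHom.bigU ψ) ∧
      (∀ x : Kˣ, ν ((x : K) - 1) < 1 → ψ (x : AlgDepHom.PK K) = 1) := by
  -- The hypothesis on lines of type (F) only serves to make the valuation nontrivial: `hF` gives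
  -- an element outside the group of products. The stated conclusion holds without it.
  have h := AlgDepHom.isDependenceHom_extendZero hlt hψ hgen
  refine ⟨h.valuationSubring.ValueGroup, inferInstance, h.valuationSubring.valuation,
    h.valuationSubring.valuation_surjective, fun x hx => ?_, fun x hx => ?_⟩
  · exact AlgDepHom.mem_bigU_of_prodInj (h.prodInj_of_valuation_eq_one hx)
  · have := h.map_one_add_of_valuation_lt_one hx
    rwa [add_sub_cancel, AlgDepHom.extendZero_unit, ← WithZero.coe_one, WithZero.coe_inj] at this
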